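/- Work in the two-sorted language of second-order arithmetic with signature $0,1,+,\times,<,=,\in$ (equality of sets is extensional). $\mathsf{RCA}_0$ consists of the axioms of a discrete ordered semiring, $\Sigma^0_1$ induction and $\Delta^0_1$ comprehension; $\mathsf{ACA}_0$ is $\mathsf{RCA}_0$ together with comprehension for all arithmetical formulas. A family of sets is a sequence $A=\langle A_i : i\in\mathbb N\rangle$ of sets of natural numbers, coded by a single set $\{(x,i) : x\in A_i\}$, where $(m,k)=(m+k)^2+m$; it is nontrivial if some $A_i\neq\emptyset$. A family $B$ is a subfamily of $A$ if $(\forall i)(\exists j)[B_i=A_j]$. For a standard $n\geq 2$, a family $A$ has the $D_n$ intersection property if the intersection of any $n$ (extensionally) distinct sets occurring in $A$ is empty. A subfamily $B$ of $A$ is a maximal subfamily with the $D_n$ intersection property if $B$ has this property and, for every subfamily $C$ of $A$ that also has it, if $B$ is a subfamily of $C$ then $C$ is a subfamily of $B$. Let $D_n\mathsf{IP}$ be the sentence "every nontrivial family of sets has a maximal subfamily with the $D_n$ intersection property". **Proposition.** For each standard $n\geq 2$, $D_n\mathsf{IP}$ is equivalent to $\mathsf{ACA}_0$ over $\mathsf{RCA}_0$;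 that is, every axiom of $\mathsf{ACA}_0$ is a logical consequence of $\mathsf{RCA}_0+D_n\mathsf{IP}$, and $D_n\mathsf{IP}$ is a logical consequence of $\mathsf{ACA}_0$. (Here $\varphi$ is a logical consequence of a theory $T$ if $\varphi$ is true in every, not necessarily standard, structure for the language in which all axioms of $T$ are true; by the completeness theorem this is the same as provability from $T$.) -/

import Mathlib

/-! Second-order arithmetic: the two-sorted language `L₂`, its structures, the subsystems
`RCA₀` and `ACA₀`, and the intersection principle `D_n IP`. -/

universe u

namespace SOA

/-- Number terms over the signature `0, 1, +, ×`; the number variables are `x₀, x₁, …`. -/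
inductive Term : Type
  | var : ℕ → Term
  | zero : Term
  | one : Term
  | add : Term → Term → Term
  | mul : Term → Term → Term

/-- `L₂`-formulas, with number variables `x₀, x₁, …` and set variables `X₀, X₁, …`.
There is no equality symbol for sets: equality of sets is defined by extensionality. -/
inductive Formula : Type
  | eq : Term → Term → Formula
  | lt : Term → Term → Formula
  /-- `mem t j` is `t ∈ X_j`. -/
  | mem : Term → ℕ → Formula
  | neg : Formula → Formula
  | and : Formula → Formula → Formula
  | or : Formula → Formula → Formula
  | imp : Formula → Formula → Formula
  /-- `all i φ` is `∀ x_i, φ`. -/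
  | all : ℕ → Formula → Formula
  /-- `ex i φ` is `∃ x_i, φ`. -/
  | ex : ℕ → Formula → Formula
  /-- `allSet j φ` is `∀ X_j, φ`. -/
  | allSet : ℕ → Formula → Formula
  /-- `exSet j φ` is `∃ X_j, φ`. -/
  | exSet : ℕ → Formula → Formula

/-- The number variable `x_i` occurs in the term. -/
def Term.Mentions (i : ℕ) : Term → Prop
  | .var k => k = i
  | .zero => False
  | .one => False
  | .add s t => s.Mentions i ∨ t.Mentions i
  | .mul s t => s.Mentions i ∨ t.Mentions i

namespace Formula

/-- The number variable `x_i` occurs (free or bound) in the formula. -/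
def MentionsNum (i : ℕ) : Formula → Prop
  | .eq s t => s.Mentions i ∨ t.Mentions i
  | .lt s t => s.Mentions i ∨ t.Mentions i
  | .mem t _ => t.Mentions i
  | .neg φ => φ.MentionsNum i
  | .and φ ψ => φ.MentionsNum i ∨ ψ.MentionsNum i
  | .or φ ψ => φ.MentionsNum i ∨ ψ.MentionsNum i
  | .imp φ ψ => φ.MentionsNum i ∨ ψ.MentionsNum i
  | .all k φ => k = i ∨ φ.MentionsNum i
  | .ex k φ => k = i ∨ φ.MentionsNum i
  | .allSet _ φ => φ.MentionsNum i
  | .exSet _ φ => φ.MentionsNum i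

/-- The set variable `X_j` occurs (free or bound) in the formula. -/
def MentionsSet (j : ℕ) : Formula → Prop
  | .eq _ _ => False
  | .lt _ _ => False
  | .mem _ k => k = j
  | .neg φ => φ.MentionsSet j
  | .and φ ψ => φ.MentionsSet j ∨ ψ.MentionsSet j
  | .or φ ψ => φ.MentionsSet j ∨ ψ.MentionsSet j
  | .imp φ ψ => φ.MentionsSet j ∨ ψ.MentionsSet j
  | .all _ φ => φ.MentionsSet j
  | .ex _ φ => φ.MentionsSet j
  | .allSet k φ => k = j ∨ φ.MentionsSet j
  | .exSet k φ => k = j ∨ φ.MentionsSet j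

/-- `φ ↔ ψ`. -/
def iff (φ ψ : Formula) : Formula := (φ.imp ψ).and (ψ.imp φ)

/-- Bounded quantifier formulas (`Σ⁰₀`): all number quantifiers are of the form `∀ x_i < t` or
`∃ x_i < t` with `x_i` not in `t`, and there are no set quantifiers. -/
inductive IsSigma00 : Formula → Prop
  | eq (s t : Term) : IsSigma00 (.eq s t)
  | lt (s t : Term) : IsSigma00 (.lt s t)
  | mem (t : Term) (j : ℕ) : IsSigma00 (.mem t j)
  | neg {φ : Formula} : IsSigma00 φ → IsSigma00 (.neg φ)
  | and {φ ψ : Formula} : IsSigma00 φ → IsSigma00 ψ → IsSigma00 (.and φ ψ)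
  | or {φ ψ : Formula} : IsSigma00 φ → IsSigma00 ψ → IsSigma00 (.or φ ψ)
  | imp {φ ψ : Formula} : IsSigma00 φ → IsSigma00 ψ → IsSigma00 (.imp φ ψ)
  | ball {φ : Formula} (i : ℕ) (t : Term) : ¬ t.Mentions i → IsSigma00 φ →
      IsSigma00 (.all i (.imp (.lt (.var i) t) φ))
  | bex {φ : Formula} (i : ℕ) (t : Term) : ¬ t.Mentions i → IsSigma00 φ →
      IsSigma00 (.ex i (.and (.lt (.var i) t) φ))

/-- `Σ⁰₁` formulas: `∃ x_i, θ` with `θ` a bounded quantifier formula. -/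
def IsSigma01 (φ : Formula) : Prop := ∃ (i : ℕ) (θ : Formula), θ.IsSigma00 ∧ φ = .ex i θ

/-- `Π⁰₁` formulas: `∀ x_i, θ` with `θ` a bounded quantifier formula. -/
def IsPi01 (φ : Formula) : Prop := ∃ (i : ℕ) (θ : Formula), θ.IsSigma00 ∧ φ = .all i θ

/-- Arithmetical formulas: no set quantifiers (set parameters are allowed). -/
def IsArithmetical : Formula → Prop
  | .eq _ _ => True
  | .lt _ _ => True
  | .mem _ _ => True
  | .neg φ => φ.IsArithmetical
  | .and φ ψ => φ.IsArithmetical ∧ ψ.IsArithmetical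
  | .or φ ψ => φ.IsArithmetical ∧ ψ.IsArithmetical
  | .imp φ ψ => φ.IsArithmetical ∧ ψ.IsArithmetical
  | .all _ φ => φ.IsArithmetical
  | .ex _ φ => φ.IsArithmetical
  | .allSet _ _ => False
  | .exSet _ _ => False

/-- `φ(t)`, the result of putting `t` for `x_i` in `φ`, written without a substitution operation as
`∀ y (y = t → ∀ x_i (x_i = y → φ))`, where `y = x_k` is a fresh variable. -/
def inst (i k : ℕ) (t : Term) (φ : Formula) : Formula :=
  .all k (.imp (.eq (.var k) t) (.all i (.imp (.eq (.var i) (.var k)) φ)))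

end Formula

/-- An `L₂`-structure: a nonempty set of numbers, a nonempty collection of sets, and
interpretations of the symbols of the language.  Nothing is assumed to be standard. -/
structure L2Structure where
  Num : Type u
  Sets : Type u
  nonemptySets : Nonempty Sets
  zero : Num
  one : Num
  add : Num → Num → Num
  mul : Num → Num → Num
  lt : Num → Num → Prop
  mem : Num → Sets → Prop

/-- The value of a term under an assignment of the number variables. -/
def Term.val (M : L2Structure.{u}) (e : ℕ → M.Num) : Term → M.Num
  | .var i => e i
  | .zero => M.zero
  | .one => M.one
  | .add s t => M.add (s.val M e) (t.val M e)
  | .mul s t => M.mul (s.val M e) (t.val M e)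

/-- Tarskian truth of a formula in `M` under assignments `e`, `E` of number and set variables. -/
def Formula.Sat (M : L2Structure.{u}) : Formula → (ℕ → M.Num) → (ℕ → M.Sets) → Prop
  | .eq s t, e, _ => s.val M e = t.val M e
  | .lt s t, e, _ => M.lt (s.val M e) (t.val M e)
  | .mem t j, e, E => M.mem (t.val M e) (E j)
  | .neg φ, e, E => ¬ φ.Sat M e E
  | .and φ ψ, e, E => φ.Sat M e E ∧ ψ.Sat M e E
  | .or φ ψ, e, E => φ.Sat M e E ∨ ψ.Sat M e E
  | .imp φ ψ, e, E => φ.Sat M e E → ψ.Sat M e E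
  | .all i φ, e, E => ∀ a : M.Num, φ.Sat M (Function.update e i a) E
  | .ex i φ, e, E => ∃ a : M.Num, φ.Sat M (Function.update e i a) E
  | .allSet j φ, e, E => ∀ A : M.Sets, φ.Sat M e (Function.update E j A)
  | .exSet j φ, e, E => ∃ A : M.Sets, φ.Sat M e (Function.update E j A)

/-- `M ⊨ φ`: the universal closure of `φ` is true in `M`. -/
def L2Structure.Models (M : L2Structure.{u}) (φ : Formula) : Prop :=
  ∀ (e : ℕ → M.Num) (E : ℕ → M.Sets), φ.Sat M e E

/-- A theory is a set of axioms; an axiom with free variables stands for its universal closure. -/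
abbrev Theory : Type := Set Formula

/-- `φ` is a consequence of `T`: it holds in every `L₂`-structure, `ω`-model or not, that satisfies
all the axioms of `T` (equivalently, by the completeness theorem, `T` proves `φ`). -/
def Theory.Entails (T : Theory) (φ : Formula) : Prop :=
  ∀ M : L2Structure.{u}, (∀ ψ ∈ T, M.Models ψ) → M.Models φ

/-- `U` and `V` are equivalent over `T`: `T ∪ U` yields every axiom of `V`, and `T ∪ V` yields every
axiom of `U`. -/
def Theory.EquivalentOver (T U V : Theory) : Prop :=
  (∀ φ ∈ V, Theory.Entails.{u} (T ∪ U) φ) ∧ (∀ φ ∈ U, Theory.Entails.{u} (T ∪ V) φ)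

section axioms

open Term Formula

/-- The axioms of a discrete ordered semiring, in the variables `x₀, x₁, x₂`. -/
inductive SemiringAxiom : Formula → Prop
  | add_assoc : SemiringAxiom (eq (add (add (var 0) (var 1)) (var 2))
      (add (var 0) (add (var 1) (var 2))))
  | add_comm : SemiringAxiom (eq (add (var 0) (var 1)) (add (var 1) (var 0)))
  | mul_assoc : SemiringAxiom (eq (mul (mul (var 0) (var 1)) (var 2))
      (mul (var 0) (mul (var 1) (var 2))))
  | mul_comm : SemiringAxiom (eq (mul (var 0) (var 1)) (mul (var 1) (var 0)))
  | mul_add : SemiringAxiom (eq (mul (var 0) (add (var 1) (var 2)))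
      (add (mul (var 0) (var 1)) (mul (var 0) (var 2))))
  | add_zero : SemiringAxiom (eq (add (var 0) zero) (var 0))
  | mul_zero : SemiringAxiom (eq (mul (var 0) zero) zero)
  | mul_one : SemiringAxiom (eq (mul (var 0) one) (var 0))
  | lt_trans : SemiringAxiom (imp (and (lt (var 0) (var 1)) (lt (var 1) (var 2)))
      (lt (var 0) (var 2)))
  | lt_irrefl : SemiringAxiom (neg (lt (var 0) (var 0)))
  | lt_total : SemiringAxiom (or (lt (var 0) (var 1)) (or (eq (var 0) (var 1))
      (lt (var 1) (var 0))))
  | add_lt_add : SemiringAxiom (imp (lt (var 0) (var 1))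
      (lt (add (var 0) (var 2)) (add (var 1) (var 2))))
  | mul_lt_mul : SemiringAxiom (imp (and (lt zero (var 2)) (lt (var 0) (var 1)))
      (lt (mul (var 0) (var 2)) (mul (var 1) (var 2))))
  | exists_add : SemiringAxiom (imp (lt (var 0) (var 1))
      (ex 2 (eq (add (var 0) (var 2)) (var 1))))
  | zero_lt_one : SemiringAxiom (lt zero one)
  | one_le_of_pos : SemiringAxiom (imp (lt zero (var 0)) (or (eq one (var 0)) (lt one (var 0))))
  | zero_le : SemiringAxiom (or (eq zero (var 0)) (lt zero (var 0)))

/-- `Σ⁰₁` induction: `φ(0) ∧ ∀ x (φ(x) → φ(x + 1)) → ∀ x φ(x)` for `φ` in `Σ⁰₁`. -/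
inductive Sigma01Induction : Formula → Prop
  | mk (φ : Formula) (i k : ℕ) : φ.IsSigma01 → k ≠ i → ¬ φ.MentionsNum k →
      Sigma01Induction
        (imp (and (φ.inst i k zero) (all i (imp φ (φ.inst i k (add (var i) one))))) (all i φ))

/-- `Δ⁰₁` comprehension: `∀ x (φ(x) ↔ ψ(x)) → ∃ X ∀ x (x ∈ X ↔ φ(x))` for `φ` in `Σ⁰₁` and `ψ` in
`Π⁰₁` that do not mention `X`. -/
inductive Delta01Comprehension : Formula → Prop
  | mk (φ ψ : Formula) (i j : ℕ) : φ.IsSigma01 → ψ.IsPi01 →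
      ¬ φ.MentionsSet j → ¬ ψ.MentionsSet j →
      Delta01Comprehension
        (imp (all i (iff φ ψ)) (exSet j (all i (iff (mem (var i) j) φ))))

/-- Arithmetical comprehension: `∃ X ∀ x (x ∈ X ↔ φ(x))` for `φ` arithmetical and not mentioning
`X`. -/
inductive ArithmeticalComprehension : Formula → Prop
  | mk (φ : Formula) (i j : ℕ) : φ.IsArithmetical → ¬ φ.MentionsSet j →
      ArithmeticalComprehension (exSet j (all i (iff (mem (var i) j) φ)))

end axioms

/-- `RCA₀`. -/
def RCA0 : Theory :=
  {φ | SemiringAxiom φ ∨ Sigma01Induction φ ∨ Delta01Comprehension φ}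

/-- `ACA₀`. -/
def ACA0 : Theory :=
  RCA0 ∪ {φ | ArithmeticalComprehension φ}

section principle

open Term Formula

/-- The code `(s + t)² + s` of the pair `(s, t)`. -/
def pair (s t : Term) : Term := add (mul (add s t) (add s t)) s

/-- A set `A` codes the family `⟨A_i⟩` with `A_i = {x : (x, i) ∈ A}`.  This is `x ∈ A_i`, for
`A = X_a`. -/
def memRow (x : Term) (a : ℕ) (i : Term) : Formula := mem (pair x i) a

/-- `A_i = B_j` for `A = X_a`, `B = X_b`: `∀ x_k (x_k ∈ A_i ↔ x_k ∈ B_j)`; used only with `x_k` not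
in `i` and `j`. -/
def rowEq (k a : ℕ) (i : Term) (b : ℕ) (j : Term) : Formula :=
  all k (iff (memRow (var k) a i) (memRow (var k) b j))

/-- The family `X_a` is nontrivial: some `A_i` is nonempty. -/
def nontrivialFamily (a : ℕ) : Formula := ex 0 (ex 1 (memRow (var 1) a (var 0)))

/-- The family `X_b` is a subfamily of the family `X_a`: `∀ i ∃ j, B_i = A_j`. -/
def subfamily (b a : ℕ) : Formula := all 0 (ex 1 (rowEq 2 b (var 0) a (var 1)))

/-- The conjunction of a finite list of formulas. -/
def conj : List Formula → Formula
  | [] => eq zero zero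
  | φ :: l => and φ (conj l)

/-- `∀ x₀ … ∀ x_{n-1}, φ`. -/
def allBlock : ℕ → Formula → Formula
  | 0, φ => φ
  | n + 1, φ => allBlock n (all n φ)

/-- The `D_n` intersection property of the family `A = X_a`: for all `x₀, …, x_{n-1}` such that the
sets `A_{x₀}, …, A_{x_{n-1}}` are pairwise distinct, no number lies in all of them. -/
def hasDn (n a : ℕ) : Formula :=
  allBlock n (imp
    (conj ((List.range n).flatMap fun l =>
      (List.range l).map fun k => neg (rowEq n a (var k) a (var l))))
    (neg (ex n (conj ((List.range n).map fun k => memRow (var n) a (var k))))))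

/-- `X_b` is a maximal subfamily of `X_a` with the `D_n` intersection property (`X_c` is the set
variable for the competing subfamilies; used only with `a`, `b`, `c` distinct). -/
def maximalSubfamily (n c b a : ℕ) : Formula :=
  and (subfamily b a) (and (hasDn n b)
    (allSet c (imp (and (subfamily c a) (hasDn n c)) (imp (subfamily b c) (subfamily c b)))))

/-- `D_n IP`: every nontrivial family of sets has a maximal subfamily with the `D_n` intersection
property. -/
def DnIP (n : ℕ) : Formula :=
  allSet 0 (imp (nontrivialFamily 0) (exSet 1 (maximalSubfamily n 2 1 0)))

end principle

end SOA

/-! Both directions go through `Σ⁰₁` comprehension, which over `RCA₀` is equivalent to arithmetical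
comprehension: once the projections of `Σ⁰₀` relations are sets, they can be used as set parameters,
so that by induction on formulas every arithmetical relation is `Σ⁰₀` in suitable parameters
(`definable_sat`). The syntax is handled through the semantic notion `Definable`, a relation on the
numbers of a structure that some `Σ⁰₀` formula with set parameters defines, and its closure
properties; `models_DnIP` gives the meaning of `D_n IP` in these terms.

From `D_n IP` to `Σ⁰₁` comprehension (`sigmaComp_of_models_DnIP`): given a `Σ⁰₀` relation `R`, let
the set with index `(i, l)` consist of a point of its own and of one point for each witness `s` of
`R i s`, the latter points being the same for all `l`. If `i` has no witness, the sets `(i, l)` are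
disjoint from all the others, so each of them occurs in a maximal subfamily `B`. If `i` has a
witness, the sets `(i, 0), …, (i, n - 1)` have a common point and cannot all occur in `B`. Hence
"`i` has no witness" is `Σ⁰₁` in `B`, and `Δ⁰₁` comprehension applies. No induction is used.

From `ACA₀` to `D_n IP` (`exists_isMaximalD`): go through the family and keep a set if this does not
violate the `D_n` property together with the sets kept before. This is a recursion in which each
step is arithmetical in the finite set of earlier choices; finite sets are coded by numbers by means
of divisibility by the pairwise coprime moduli `1 + (i + 1) m` (`exists_inCode`), after which the
recursion is an instance of arithmetical comprehension (`exists_set_of_recursion`). -/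

namespace SOA

/-! ### Models of `RCA₀` as ordered semirings -/

/-- `M` is a model of `RCA₀`. -/
class ModelsRCA0 (M : L2Structure.{u}) : Prop where
  models : ∀ ψ ∈ RCA0, M.Models ψ

section arithmetic

variable {M : L2Structure.{u}}

instance : Zero M.Num := ⟨M.zero⟩
instance : One M.Num := ⟨M.one⟩
instance : Add M.Num := ⟨M.add⟩
instance : Mul M.Num := ⟨M.mul⟩
instance : LT M.Num := ⟨M.lt⟩
instance : LE M.Num := ⟨fun a b => a < b ∨ a = b⟩
instance : Inhabited M.Num := ⟨0⟩
instance : Nonempty M.Sets := M.nonemptySets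

/-- The assignment `x₀ ↦ a, x₁ ↦ b, x₂ ↦ c` under which the semiring axioms are read. -/
def assign₃ (a b c : M.Num) : ℕ → M.Num
  | 0 => a
  | 1 => b
  | _ => c

variable [hM : ModelsRCA0 M]

lemma SemiringAxiom.sat {φ : Formula} (h : SemiringAxiom φ) (e : ℕ → M.Num) :
    φ.Sat M e fun _ => Classical.arbitrary _ :=
  hM.models φ (Or.inl h) e _

open SemiringAxiom in
noncomputable instance : CommSemiring M.Num where
  add_assoc a b c := add_assoc.sat (assign₃ a b c)
  add_comm a b := add_comm.sat (assign₃ a b b)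
  zero_add a := (add_comm.sat (assign₃ 0 a a)).trans (add_zero.sat (assign₃ a a a))
  add_zero a := add_zero.sat (assign₃ a a a)
  mul_assoc a b c := mul_assoc.sat (assign₃ a b c)
  mul_comm a b := mul_comm.sat (assign₃ a b b)
  zero_mul a := (mul_comm.sat (assign₃ 0 a a)).trans (mul_zero.sat (assign₃ a a a))
  mul_zero a := mul_zero.sat (assign₃ a a a)
  one_mul a := (mul_comm.sat (assign₃ 1 a a)).trans (mul_one.sat (assign₃ a a a))
  mul_one a := mul_one.sat (assign₃ a a a)
  left_distrib a b c := mul_add.sat (assign₃ a b c)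
  right_distrib a b c := (mul_comm.sat (assign₃ (a + b) c c)).trans
    ((mul_add.sat (assign₃ c a b)).trans
      (congrArg₂ M.add (mul_comm.sat (assign₃ c a b)) (mul_comm.sat (assign₃ c b b))))
  nsmul := nsmulRec

lemma num_lt_trans {a b c : M.Num} (h : a < b) (h' : b < c) : a < c :=
  SemiringAxiom.lt_trans.sat (assign₃ a b c) ⟨h, h'⟩

lemma num_lt_irrefl (a : M.Num) : ¬ a < a := SemiringAxiom.lt_irrefl.sat (assign₃ a a a)

open Classical in
noncomputable instance : LinearOrder M.Num where
  le_refl _ := Or.inr rfl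
  le_trans a b c := by
    rintro (h | rfl) (h' | rfl)
    · exact Or.inl (num_lt_trans h h')
    · exact Or.inl h
    · exact Or.inl h'
    · exact Or.inr rfl
  le_antisymm a b := by
    rintro (h | rfl) (h' | h')
    · exact absurd (num_lt_trans h h') (num_lt_irrefl a)
    all_goals simp_all
  lt_iff_le_not_ge a b := by
    refine ⟨fun h => ⟨Or.inl h, ?_⟩, ?_⟩
    · rintro (h' | rfl)
      · exact num_lt_irrefl a (num_lt_trans h h')
      · exact num_lt_irrefl _ h
    · rintro ⟨h | rfl, h'⟩
      · exact h
      · exact absurd (Or.inr rfl) h'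
  le_total a b := by
    rcases SemiringAxiom.lt_total.sat (assign₃ a b b) with h | h | h
    · exact Or.inl (Or.inl h)
    · exact Or.inl (Or.inr h)
    · exact Or.inr (Or.inl h)
  toDecidableLE := Classical.decRel _

lemma num_add_lt_add {a b : M.Num} (c : M.Num) (h : a < b) : a + c < b + c :=
  SemiringAxiom.add_lt_add.sat (assign₃ a b c) h

lemma num_mul_lt_mul {a b c : M.Num} (hc : 0 < c) (h : a < b) : a * c < b * c :=
  SemiringAxiom.mul_lt_mul.sat (assign₃ a b c) ⟨hc, h⟩

lemma num_zero_le (a : M.Num) : 0 ≤ a := by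
  rcases SemiringAxiom.zero_le.sat (assign₃ a a a) with h | h
  · exact Or.inr h
  · exact Or.inl h

instance : IsStrictOrderedRing M.Num :=
  have h₁ : ∀ a b : M.Num, a ≤ b → ∀ c, a + c ≤ b + c := by
    rintro a b (h | rfl) c
    · exact Or.inl (num_add_lt_add c h)
    · exact le_rfl
  have h₂ : ∀ a b c : M.Num, a + b ≤ a + c → b ≤ c := fun a b c h => by
    by_contra! h'
    have := num_add_lt_add a h'
    rw [add_comm c, add_comm b] at this
    exact absurd h this.not_ge
  { add_le_add_left := h₁
    le_of_add_le_add_left := h₂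
    zero_le_one := num_zero_le 1
    exists_pair_ne := ⟨0, 1, fun h => num_lt_irrefl (M := M) 1 <| by
      have : (0 : M.Num) < 1 := SemiringAxiom.zero_lt_one.sat (assign₃ 0 0 0)
      rwa [h] at this⟩
    mul_lt_mul_of_pos_left := fun c hc a b h => by
      simpa only [mul_comm] using num_mul_lt_mul hc h
    mul_lt_mul_of_pos_right := fun c hc a b h => num_mul_lt_mul hc h }

instance : CanonicallyOrderedAdd M.Num where
  le_self_add a b := by simpa using add_le_add_right (num_zero_le b) a
  le_add_self a b := by simpa using add_le_add_left (num_zero_le b) a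
  exists_add_of_le := by
    rintro a b (h | rfl)
    · obtain ⟨c, hc⟩ := SemiringAxiom.exists_add.sat (assign₃ a b b) h
      exact ⟨c, hc.symm⟩
    · exact ⟨0, (add_zero a).symm⟩

lemma num_one_le {a : M.Num} (h : 0 < a) : 1 ≤ a := by
  rcases SemiringAxiom.one_le_of_pos.sat (assign₃ a a a) h with h | h
  · exact Or.inr h
  · exact Or.inl h

lemma num_eq_zero_or_succ (a : M.Num) : a = 0 ∨ ∃ b, a = b + 1 := by
  rcases eq_or_ne a 0 with h | h
  · exact Or.inl h
  · obtain ⟨c, hc⟩ := exists_add_of_le (num_one_le (pos_iff_ne_zero.2 h))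
    exact Or.inr ⟨c, by rw [hc, add_comm]⟩

lemma num_lt_add_one {a b : M.Num} : a < b + 1 ↔ a ≤ b := by
  refine ⟨fun h => ?_, fun h => lt_of_le_of_lt h (lt_add_one b)⟩
  by_contra! h'
  obtain ⟨c, rfl⟩ := exists_add_of_le h'.le
  rcases num_eq_zero_or_succ c with rfl | ⟨d, rfl⟩
  · simp at h'
  · have : b + 1 ≤ b + (d + 1) := by gcongr; exact le_add_self
    exact absurd h this.not_gt

/-- The pairing function `(s, t) ↦ (s + t)² + s` that codes families. -/
def npair (s t : M.Num) : M.Num := (s + t) * (s + t) + s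

lemma le_mul_self (a : M.Num) : a ≤ a * a := by
  rcases num_eq_zero_or_succ a with rfl | ⟨b, rfl⟩
  · simp
  · exact le_mul_of_one_le_left' le_add_self

lemma left_le_npair (s t : M.Num) : s ≤ npair s t := le_add_self

lemma right_le_npair (s t : M.Num) : t ≤ npair s t :=
  (le_add_self.trans (le_mul_self (s + t))).trans le_self_add

lemma add_le_of_npair_eq {s t s' t' : M.Num} (h : npair s t = npair s' t') :
    s' + t' ≤ s + t := by
  by_contra! hlt
  obtain ⟨d, hd⟩ := exists_add_of_le hlt.le
  rcases num_eq_zero_or_succ d with rfl | ⟨d, rfl⟩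
  · rw [hd] at hlt; simp at hlt
  · -- `(s + t)² + s < (s + t + 1)²`, so no larger sum gives the same code
    have : npair s t < npair s' t' := by
      unfold npair
      rw [hd]
      have h1 : (s + t + (d + 1)) * (s + t + (d + 1)) + s' = ((s + t) * (s + t) + s) +
        (s + t + t + 1 + (2 * (s + t) * d + (d + 2) * d) + s') := by ring
      rw [h1]
      refine lt_add_of_pos_right _ (pos_iff_ne_zero.2 fun h0 => ?_)
      simp at h0
    exact absurd h this.ne

lemma npair_inj {s t s' t' : M.Num} : npair s t = npair s' t' ↔ s = s' ∧ t = t' := by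
  refine ⟨fun h => ?_, by rintro ⟨rfl, rfl⟩; rfl⟩
  have h1 := le_antisymm (add_le_of_npair_eq h.symm) (add_le_of_npair_eq h)
  unfold npair at h
  rw [h1] at h
  have h2 := add_left_cancel h
  subst h2
  exact ⟨rfl, add_left_cancel h1⟩

end arithmetic

/-! ### Renaming of variables -/

/-- Renames the number variables of a term. -/
def Term.rename (f : ℕ → ℕ) : Term → Term
  | .var i => .var (f i)
  | .zero => .zero
  | .one => .one
  | .add s t => .add (s.rename f) (t.rename f)
  | .mul s t => .mul (s.rename f) (t.rename f)

/-- Renames the number variables of a formula, bound ones included, by `f` and its set variables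
by `g`. -/
def Formula.rename (f g : ℕ → ℕ) : Formula → Formula
  | .eq s t => .eq (s.rename f) (t.rename f)
  | .lt s t => .lt (s.rename f) (t.rename f)
  | .mem t j => .mem (t.rename f) (g j)
  | .neg φ => .neg (φ.rename f g)
  | .and φ ψ => .and (φ.rename f g) (ψ.rename f g)
  | .or φ ψ => .or (φ.rename f g) (ψ.rename f g)
  | .imp φ ψ => .imp (φ.rename f g) (ψ.rename f g)
  | .all i φ => .all (f i) (φ.rename f g)
  | .ex i φ => .ex (f i) (φ.rename f g)
  | .allSet j φ => .allSet (g j) (φ.rename f g)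
  | .exSet j φ => .exSet (g j) (φ.rename f g)

lemma Term.val_rename (M : L2Structure.{u}) (f : ℕ → ℕ) (e : ℕ → M.Num) (t : Term) :
    (t.rename f).val M e = t.val M (e ∘ f) := by
  induction t <;> simp_all [Term.rename, Term.val]

lemma Term.mentions_rename {f : ℕ → ℕ} {i : ℕ} {t : Term} (h : (t.rename f).Mentions i) :
    ∃ k, t.Mentions k ∧ f k = i := by
  induction t with
  | var k => exact ⟨k, rfl, h⟩
  | zero => exact h.elim
  | one => exact h.elim
  | add s t hs ht | mul s t hs ht =>
    rcases h with h | h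
    · exact (hs h).imp fun k hk => ⟨Or.inl hk.1, hk.2⟩
    · exact (ht h).imp fun k hk => ⟨Or.inr hk.1, hk.2⟩

lemma Term.val_congr (M : L2Structure.{u}) {e e' : ℕ → M.Num} {t : Term}
    (h : ∀ i, t.Mentions i → e i = e' i) : t.val M e = t.val M e' := by
  induction t with
  | var k => exact h k rfl
  | zero => rfl
  | one => rfl
  | add s t hs ht | mul s t hs ht =>
    simp only [Term.val]
    rw [hs fun i hi => h i (Or.inl hi), ht fun i hi => h i (Or.inr hi)]

lemma Formula.mentionsSet_rename {f g : ℕ → ℕ} {j : ℕ} {φ : Formula}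
    (h : (φ.rename f g).MentionsSet j) : ∃ k, g k = j := by
  induction φ with
  | eq s t => exact h.elim
  | lt s t => exact h.elim
  | mem t k => exact ⟨k, h⟩
  | neg φ ih | all i φ ih | ex i φ ih => exact ih h
  | and φ ψ ih ih' | or φ ψ ih ih' | imp φ ψ ih ih' => exact h.elim ih ih'
  | allSet k φ ih | exSet k φ ih => exact h.elim (fun h => ⟨k, h⟩) ih

namespace Formula.IsSigma00

lemma rename {f : ℕ → ℕ} (hf : f.Injective) (g : ℕ → ℕ) {φ : Formula} (h : φ.IsSigma00) :
    (φ.rename f g).IsSigma00 := by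
  have fresh : ∀ {i : ℕ} {t : Term}, ¬ t.Mentions i → ¬ (t.rename f).Mentions (f i) := by
    intro i t h h'
    obtain ⟨k, hk, hki⟩ := Term.mentions_rename h'
    exact h (hf hki ▸ hk)
  induction h with
  | eq s t => exact eq _ _
  | lt s t => exact lt _ _
  | mem t j => exact mem _ _
  | neg _ ih => exact neg ih
  | and _ _ ih ih' => exact and ih ih'
  | or _ _ ih ih' => exact or ih ih'
  | imp _ _ ih ih' => exact imp ih ih'
  | ball i t h _ ih => exact ball _ _ (fresh h) ih
  | bex i t h _ ih => exact bex _ _ (fresh h) ih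

lemma sat_rename (M : L2Structure.{u}) {f : ℕ → ℕ} (hf : f.Injective) (g : ℕ → ℕ) {φ : Formula}
    (h : φ.IsSigma00) (e : ℕ → M.Num) (E : ℕ → M.Sets) :
    (φ.rename f g).Sat M e E ↔ φ.Sat M (e ∘ f) (E ∘ g) := by
  have upd : ∀ (e : ℕ → M.Num) i a,
      Function.update e (f i) a ∘ f = Function.update (e ∘ f) i a := fun e i a =>
    Function.update_comp_eq_of_injective e hf i a
  induction h generalizing e with
  | eq s t | lt s t => simp only [Formula.rename, Formula.Sat, Term.val_rename]
  | mem t j => simp only [Formula.rename, Formula.Sat, Term.val_rename, Function.comp]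
  | neg _ ih => simp only [Formula.rename, Formula.Sat, ih]
  | and _ _ ih ih' | or _ _ ih ih' | imp _ _ ih ih' =>
    simp only [Formula.rename, Formula.Sat, ih, ih']
  | ball i t h _ ih | bex i t h _ ih =>
    simp only [Formula.rename, Formula.Sat, ih, Term.val_rename, upd, Term.val,
      Function.update_self]

end Formula.IsSigma00

/-! ### Definable predicates -/

section definable

variable {M : L2Structure.{u}}

/-- `f` is given by a term in the variables `x₀, …, x_{k-1}`. -/
def IsTermFun (k : ℕ) (f : (Fin k → M.Num) → M.Num) : Prop :=
  ∃ t : Term, (∀ i, k ≤ i → ¬ t.Mentions i) ∧ ∀ e, t.val M e = f fun i => e i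

/-- The relation `P` on the numbers of `M` is defined by a `Σ⁰₀` formula with set parameters, its
arguments being the values of `x₀, …, x_{k-1}`. The formula may use further number variables, but
its truth does not depend on their values, so there are no number parameters: those are to be
listed among the arguments of `P`. -/
def Definable (k : ℕ) (P : (Fin k → M.Num) → Prop) : Prop :=
  ∃ φ : Formula, φ.IsSigma00 ∧ ∃ E : ℕ → M.Sets, ∀ e, φ.Sat M e E ↔ P fun i => e i

variable {k : ℕ}

namespace IsTermFun

lemma var (i : Fin k) : IsTermFun k fun v : Fin k → M.Num => v i :=
  ⟨.var i, fun j hj h => by have := i.2; simp only [Term.Mentions] at h; omega, fun _ => rfl⟩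

lemma zero : IsTermFun k fun _ : Fin k → M.Num => 0 := ⟨.zero, fun _ _ h => h, fun _ => rfl⟩

lemma one : IsTermFun k fun _ : Fin k → M.Num => 1 := ⟨.one, fun _ _ h => h, fun _ => rfl⟩

variable {f g : (Fin k → M.Num) → M.Num}

lemma add (hf : IsTermFun k f) (hg : IsTermFun k g) : IsTermFun k fun v => f v + g v := by
  obtain ⟨s, hs, hs'⟩ := hf
  obtain ⟨t, ht, ht'⟩ := hg
  exact ⟨.add s t, fun i hi h => h.elim (hs i hi) (ht i hi),
    fun e => congrArg₂ M.add (hs' e) (ht' e)⟩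

lemma mul (hf : IsTermFun k f) (hg : IsTermFun k g) : IsTermFun k fun v => f v * g v := by
  obtain ⟨s, hs, hs'⟩ := hf
  obtain ⟨t, ht, ht'⟩ := hg
  exact ⟨.mul s t, fun i hi h => h.elim (hs i hi) (ht i hi),
    fun e => congrArg₂ M.mul (hs' e) (ht' e)⟩

lemma succ (hf : IsTermFun k f) : IsTermFun k fun v => f v + 1 := hf.add one

lemma npair (hf : IsTermFun k f) (hg : IsTermFun k g) :
    IsTermFun k fun v => npair (f v) (g v) :=
  ((hf.add hg).mul (hf.add hg)).add hf

lemma weaken (hf : IsTermFun k f) :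
    IsTermFun (k + 1) fun v : Fin (k + 1) → M.Num => f (Fin.init v) := by
  obtain ⟨t, ht, ht'⟩ := hf
  exact ⟨t, fun i hi => ht i (by omega), ht'⟩

lemma weaken_add (n : ℕ) (hf : IsTermFun k f) :
    IsTermFun (k + n) fun v : Fin (k + n) → M.Num => f fun i => v (Fin.castAdd n i) := by
  obtain ⟨t, ht, ht'⟩ := hf
  exact ⟨t, fun i hi => ht i (by omega), ht'⟩

end IsTermFun

namespace Definable

variable {P Q : (Fin k → M.Num) → Prop} {f g : (Fin k → M.Num) → M.Num}

lemma congr (hP : Definable k P) (h : ∀ v, P v ↔ Q v) : Definable k Q := by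
  rwa [← funext fun v => propext (h v)]

lemma eq (hf : IsTermFun k f) (hg : IsTermFun k g) : Definable k fun v => f v = g v := by
  obtain ⟨s, -, hs⟩ := hf
  obtain ⟨t, -, ht⟩ := hg
  exact ⟨.eq s t, .eq s t, fun _ => Classical.arbitrary _, fun e => by
    simp only [Formula.Sat, hs, ht]⟩

lemma lt (hf : IsTermFun k f) (hg : IsTermFun k g) : Definable k fun v => f v < g v := by
  obtain ⟨s, -, hs⟩ := hf
  obtain ⟨t, -, ht⟩ := hg
  exact ⟨.lt s t, .lt s t, fun _ => Classical.arbitrary _, fun e => by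
    simp only [Formula.Sat, hs, ht]; rfl⟩

lemma mem (hf : IsTermFun k f) (A : M.Sets) : Definable k fun v => M.mem (f v) A := by
  obtain ⟨s, -, hs⟩ := hf
  exact ⟨.mem s 0, .mem s 0, fun _ => A, fun e => by simp only [Formula.Sat, hs]⟩

lemma not (hP : Definable k P) : Definable k fun v => ¬ P v := by
  obtain ⟨φ, hφ, E, h⟩ := hP
  exact ⟨.neg φ, .neg hφ, E, fun e => not_congr (h e)⟩

/-- Two definable relations can be defined with the same set parameters. -/
lemma common_params {m : ℕ} {Q : (Fin m → M.Num) → Prop} (hP : Definable k P)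
    (hQ : Definable m Q) : ∃ φ ψ : Formula, φ.IsSigma00 ∧ ψ.IsSigma00 ∧ ∃ E : ℕ → M.Sets,
      (∀ e, φ.Sat M e E ↔ P fun i => e i) ∧ ∀ e, ψ.Sat M e E ↔ Q fun i => e i := by
  obtain ⟨φ, hφ, E, h⟩ := hP
  obtain ⟨ψ, hψ, F, h'⟩ := hQ
  -- the set parameters of the two formulas are moved to the even and to the odd set variables
  let G : ℕ → M.Sets := fun j => if j % 2 = 0 then E (j / 2) else F (j / 2)
  have hE : G ∘ (fun j => 2 * j) = E := by funext j; simp [G]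
  have hF : G ∘ (fun j => 2 * j + 1) = F := by
    funext j
    simp only [G, Function.comp]
    rw [if_neg (by omega)]
    congr 1
    omega
  refine ⟨φ.rename id fun j => 2 * j, ψ.rename id fun j => 2 * j + 1,
    hφ.rename Function.injective_id _, hψ.rename Function.injective_id _, G,
    fun e => ?_, fun e => ?_⟩
  · rw [hφ.sat_rename M Function.injective_id, hE, Function.comp_id, h]
  · rw [hψ.sat_rename M Function.injective_id, hF, Function.comp_id, h']

lemma and (hP : Definable k P) (hQ : Definable k Q) : Definable k fun v => P v ∧ Q v := by
  obtain ⟨φ, ψ, hφ, hψ, E, h, h'⟩ := hP.common_params hQ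
  exact ⟨.and φ ψ, .and hφ hψ, E, fun e => and_congr (h e) (h' e)⟩

lemma or (hP : Definable k P) (hQ : Definable k Q) : Definable k fun v => P v ∨ Q v :=
  (hP.not.and hQ.not).not.congr fun _ => by tauto

lemma imp (hP : Definable k P) (hQ : Definable k Q) : Definable k fun v => P v → Q v :=
  (hP.and hQ.not).not.congr fun _ => by tauto

lemma iff (hP : Definable k P) (hQ : Definable k Q) : Definable k fun v => P v ↔ Q v :=
  ((hP.imp hQ).and (hQ.imp hP)).congr fun _ => by tauto

lemma forall_fin {n : ℕ} {P : Fin n → (Fin k → M.Num) → Prop} (hP : ∀ i, Definable k (P i)) :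
    Definable k fun v => ∀ i, P i v := by
  induction n with
  | zero => exact (eq .zero .zero).congr fun v => by simp
  | succ n ih =>
    exact ((hP 0).and (ih fun i => hP i.succ)).congr fun v => by rw [Fin.forall_fin_succ]

lemma restrict_update (e : ℕ → M.Num) (a : M.Num) :
    (fun i : Fin (k + 1) => Function.update e k a i) = Fin.snoc (fun i : Fin k => e i) a := by
  funext i
  refine Fin.lastCases ?_ (fun i => ?_) i
  · simp
  · simp [Function.update_of_ne i.2.ne]

lemma bex_snoc {R : (Fin (k + 1) → M.Num) → Prop} (hf : IsTermFun k f)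
    (hR : Definable (k + 1) R) : Definable k fun v => ∃ a < f v, R (Fin.snoc v a) := by
  obtain ⟨t, ht, ht'⟩ := hf
  obtain ⟨φ, hφ, E, h⟩ := hR
  refine ⟨.ex k (.and (.lt (.var k) t) φ), .bex k t (ht k le_rfl) hφ, E, fun e => ?_⟩
  simp only [Formula.Sat, h, restrict_update, Term.val, Function.update_self]
  refine exists_congr fun a => and_congr ?_ Iff.rfl
  rw [Term.val_congr M (e := Function.update e k a) (e' := e), ht']
  · rfl
  · intro i hi
    refine Function.update_of_ne ?_ _ _
    rintro rfl
    exact ht i le_rfl hi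

lemma bex {R : (Fin k → M.Num) → M.Num → Prop} (hf : IsTermFun k f)
    (hR : Definable (k + 1) fun v => R (Fin.init v) (v (Fin.last k))) :
    Definable k fun v => ∃ a < f v, R v a :=
  (bex_snoc hf hR).congr fun v => by simp

lemma ball {R : (Fin k → M.Num) → M.Num → Prop} (hf : IsTermFun k f)
    (hR : Definable (k + 1) fun v => R (Fin.init v) (v (Fin.last k))) :
    Definable k fun v => ∀ a < f v, R v a :=
  (bex (R := fun v a => ¬ R v a) hf hR.not).not.congr fun v => by push Not; rfl

lemma reindex {m : ℕ} {ρ : Fin k → Fin m} (hρ : ρ.Injective) (hP : Definable k P) :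
    Definable m fun v => P fun i => v (ρ i) := by
  obtain ⟨φ, hφ, E, h⟩ := hP
  let r : ℕ → ℕ := fun i => if hi : i < k then ρ ⟨i, hi⟩ else m + i
  have hr : r.Injective := by
    intro i j hij
    simp only [r] at hij
    split_ifs at hij with hi hj hj
    · simpa using hρ (Fin.ext hij)
    · have := (ρ ⟨i, hi⟩).2; omega
    · have := (ρ ⟨j, hj⟩).2; omega
    · omega
  refine ⟨φ.rename r id, hφ.rename hr _, E, fun e => ?_⟩
  rw [hφ.sat_rename M hr, Function.comp_id, h]
  have : (fun i : Fin k => (e ∘ r) i) = fun i => e (ρ i) := by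
    funext i; simp [r]
  rw [this]

lemma bex_block {n : ℕ} {R : (Fin k → M.Num) → (Fin n → M.Num) → Prop} (hf : IsTermFun k f)
    (hR : Definable (k + n) fun v => R (fun i => v (Fin.castAdd n i)) fun i => v (Fin.natAdd k i)) :
    Definable k fun v => ∃ x : Fin n → M.Num, (∀ i, x i < f v) ∧ R v x := by
  induction n with
  | zero =>
    refine Definable.congr hR fun v => ⟨fun h => ⟨Fin.elim0, fun i => i.elim0, ?_⟩, ?_⟩
    · exact (iff_of_eq (congrArg₂ R rfl (Subsingleton.elim _ _))).1 h
    · rintro ⟨x, -, h⟩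
      exact (iff_of_eq (congrArg₂ R rfl (Subsingleton.elim _ _))).1 h
  | succ n ih =>
    refine (ih (R := fun v x => ∃ a < f v, R v (Fin.snoc x a)) (bex (hf.weaken_add n) ?_)).congr
      fun v => ?_
    · refine Definable.congr hR fun v => iff_of_eq (congrArg₂ R rfl ?_)
      funext i
      refine Fin.lastCases ?_ (fun i => ?_) i
      · simp only [Fin.snoc_last]; rfl
      · simp only [Fin.snoc_castSucc]; rfl
    · constructor
      · rintro ⟨x, hx, a, ha, h⟩
        exact ⟨Fin.snoc x a, Fin.lastCases (by simpa using ha) (by simpa using hx), h⟩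
      · rintro ⟨x, hx, h⟩
        exact ⟨Fin.init x, fun i => hx _, x (Fin.last n), hx _, by simpa using h⟩

end Definable

/-- The assignment of the values `v` to `x₀, …, x_{k-1}`, and of `0` to all other variables. -/
def assign (v : Fin k → M.Num) : ℕ → M.Num := fun i => if hi : i < k then v ⟨i, hi⟩ else M.zero

lemma assign_update (v : Fin k → M.Num) (i : ℕ) (hi : i < k) (a : M.Num) :
    Function.update (assign v) i a = assign (Function.update v ⟨i, hi⟩ a) := by
  funext j
  rcases eq_or_ne j i with rfl | h
  · simp [assign, hi]
  · by_cases hj : j < k <;> simp [assign, h, hj]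

/-! ### Coding of tuples -/

/-- The code of the tuple `(v₀, …, v_{k-1})`, obtained by iterated pairing. -/
def tcode : (k : ℕ) → (Fin k → M.Num) → M.Num
  | 0, _ => 0
  | k + 1, v => npair (tcode k (Fin.init v)) (v (Fin.last k))

lemma IsTermFun.tcode {n : ℕ} {f : Fin n → (Fin k → M.Num) → M.Num}
    (hf : ∀ i, IsTermFun k (f i)) : IsTermFun k fun v => tcode n fun i => f i v := by
  induction n with
  | zero => exact .zero
  | succ n ih => exact (ih fun i => hf i.castSucc).npair (hf (Fin.last n))

/-! ### Comprehension and induction for definable predicates -/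

variable [hM : ModelsRCA0 M]

/-- `Δ⁰₁` comprehension with number parameters `v`: a relation that is `Σ⁰₁` and whose complement
is `Σ⁰₁` defines a set. -/
lemma Definable.exists_set_of_delta {R R' : (Fin k → M.Num) → M.Num → M.Num → Prop}
    (hR : Definable (k + 2) fun v =>
      R (Fin.init (Fin.init v)) (Fin.init v (Fin.last k)) (v (Fin.last (k + 1))))
    (hR' : Definable (k + 2) fun v =>
      R' (Fin.init (Fin.init v)) (Fin.init v (Fin.last k)) (v (Fin.last (k + 1))))
    (v : Fin k → M.Num) (hRR' : ∀ a, (∃ b, R v a b) ↔ ¬ ∃ b, R' v a b) :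
    ∃ S : M.Sets, ∀ a, M.mem a S ↔ ∃ b, R v a b := by
  obtain ⟨φ, ψ, hφ, hψ, E, h, h'⟩ := hR.common_params hR'
  have fresh : ∀ φ : Formula, ¬ (φ.rename id Nat.succ).MentionsSet 0 := fun φ h0 => by
    obtain ⟨j, hj⟩ := Formula.mentionsSet_rename h0
    exact Nat.succ_ne_zero j hj
  let E' : ℕ → M.Sets := fun j => E (j - 1)
  have hE : ∀ S : M.Sets, Function.update E' 0 S ∘ Nat.succ = E := fun S => by
    funext j; simp [E']
  have hE' : E' ∘ Nat.succ = E := rfl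
  have hcomp := hM.models _ (Or.inr (Or.inr (.mk (.ex (k + 1) (φ.rename id Nat.succ))
    (.all (k + 1) (.neg (ψ.rename id Nat.succ))) k 0
    ⟨_, _, hφ.rename Function.injective_id _, rfl⟩
    ⟨_, _, .neg (hψ.rename Function.injective_id _), rfl⟩ (fresh φ) (fresh ψ))))
    (assign v) E'
  have hargs : ∀ a b : M.Num,
      (fun i : Fin (k + 2) => Function.update (Function.update (assign v) k a) (k + 1) b i) =
        Fin.snoc (Fin.snoc v a : Fin (k + 1) → M.Num) b := by
    intro a b
    rw [Definable.restrict_update, Definable.restrict_update]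
    simp [assign]
  have hφv : ∀ a b, φ.Sat M (Function.update (Function.update (assign v) k a) (k + 1) b) E ↔
      R v a b := fun a b => (h _).trans (by rw [hargs]; simp)
  have hψv : ∀ a b, ψ.Sat M (Function.update (Function.update (assign v) k a) (k + 1) b) E ↔
      R' v a b := fun a b => (h' _).trans (by rw [hargs]; simp)
  simp only [Formula.Sat, Formula.iff, hφ.sat_rename M Function.injective_id,
    hψ.sat_rename M Function.injective_id, hE, hE', Function.comp_id, hφv, hψv, Term.val,
    Function.update_self] at hcomp
  obtain ⟨S, hS⟩ := hcomp fun a => by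
    have := hRR' a
    push Not at this
    exact ⟨this.1, this.2⟩
  exact ⟨S, fun a => ⟨(hS a).1, (hS a).2⟩⟩

/-- Comprehension for definable relations with number parameters `v`. -/
lemma Definable.exists_set {R : (Fin k → M.Num) → M.Num → Prop}
    (hR : Definable (k + 1) fun v => R (Fin.init v) (v (Fin.last k))) (v : Fin k → M.Num) :
    ∃ S : M.Sets, ∀ a, M.mem a S ↔ R v a := by
  have h : Definable (k + 2) fun v : Fin (k + 2) → M.Num =>
      R (Fin.init (Fin.init v)) (Fin.init v (Fin.last k)) :=
    hR.reindex (Fin.castSucc_injective _)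
  obtain ⟨S, hS⟩ := Definable.exists_set_of_delta (R := fun v a _ => R v a)
    (R' := fun v a _ => ¬ R v a) h h.not v fun a => by simp
  exact ⟨S, fun a => by simpa using hS a⟩

lemma set_induction (S : M.Sets) (h0 : M.mem 0 S) (hs : ∀ a, M.mem a S → M.mem (a + 1) S) (a) :
    M.mem a S := by
  have h := hM.models _ (Or.inr (Or.inl (.mk (.ex 1 (.mem (.var 0) 0)) 0 2
    ⟨1, _, .mem _ _, rfl⟩ (by decide) (by simp [Formula.MentionsNum, Term.Mentions]))))
    (fun _ => 0) (fun _ => S)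
  simp only [Formula.Sat, Formula.inst, Term.val] at h
  have := h ⟨?_, ?_⟩ a
  · simpa using this
  · rintro c hc b hb
    simp only [Function.update_self, ne_eq, OfNat.ofNat_ne_zero, not_false_eq_true,
      Function.update_of_ne] at hc hb
    refine ⟨0, ?_⟩
    simp only [ne_eq, zero_ne_one, not_false_eq_true, Function.update_of_ne, Function.update_self]
    rw [hb, hc]
    exact h0
  · rintro b ⟨_, hb⟩ c hc d hd
    refine ⟨0, ?_⟩
    simp at hb hc hd ⊢
    rw [hd, hc]
    exact hs b hb

lemma Definable.induction {R : (Fin k → M.Num) → M.Num → Prop}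
    (hR : Definable (k + 1) fun v => R (Fin.init v) (v (Fin.last k))) (v : Fin k → M.Num)
    (h0 : R v 0) (hs : ∀ a, R v a → R v (a + 1)) (a : M.Num) : R v a := by
  obtain ⟨S, hS⟩ := hR.exists_set v
  exact (hS a).1 (set_induction S ((hS 0).2 h0) (fun b hb => (hS _).2 (hs b ((hS b).1 hb))) a)

lemma tcode_inj {v w : Fin k → M.Num} : tcode k v = tcode k w ↔ v = w := by
  refine ⟨fun h => ?_, fun h => h ▸ rfl⟩
  induction k with
  | zero => exact Subsingleton.elim _ _
  | succ k ih =>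
    obtain ⟨h1, h2⟩ := npair_inj.1 h
    rw [← Fin.snoc_init_self v, ← Fin.snoc_init_self w, ih h1, h2]

lemma le_tcode (v : Fin k → M.Num) (i : Fin k) : v i ≤ tcode k v := by
  induction k with
  | zero => exact i.elim0
  | succ k ih =>
    refine Fin.lastCases (right_le_npair _ _) (fun i => ?_) i
    exact (ih (Fin.init v) i).trans (left_le_npair _ _)

/-- The relation obtained from `R` by coding a block of `k` arguments into one is definable
without an unbounded quantifier, because the entries of a tuple are bounded by its code. -/
lemma Definable.code {m : ℕ} {R : (Fin m → M.Num) → (Fin k → M.Num) → Prop}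
    (hR : Definable (m + k) fun v => R (fun i => v (Fin.castAdd k i)) fun i => v (Fin.natAdd m i)) :
    Definable (m + 1) fun v => ∃ x, v (Fin.last m) = tcode k x ∧ R (Fin.init v) x := by
  have h : Definable (m + 1) fun v : Fin (m + 1) → M.Num => ∃ x : Fin k → M.Num,
      (∀ i, x i < v (Fin.last m) + 1) ∧ (v (Fin.last m) = tcode k x ∧ R (Fin.init v) x) := by
    refine bex_block (.succ (.var _)) (.and ?_ ?_)
    · exact .eq (.var _) (.tcode fun i => .var _)
    · let ρ : Fin (m + k) → Fin (m + 1 + k) :=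
        Fin.addCases (fun i => Fin.castAdd k i.castSucc) (fun i => Fin.natAdd (m + 1) i)
      have hρ : ρ.Injective := by
        intro i j hij
        induction i using Fin.addCases <;> induction j using Fin.addCases <;>
          simp [ρ, Fin.ext_iff] at hij ⊢ <;> omega
      refine (hR.reindex hρ).congr fun v => ?_
      simp only [ρ, Fin.addCases_left, Fin.addCases_right]
      rfl
  refine h.congr fun v => exists_congr fun x => ⟨fun hx => hx.2, fun hx => ⟨fun i => ?_, hx⟩⟩
  rw [num_lt_add_one, hx.1]
  exact le_tcode x i

end definable

/-! ### Occurring variables and assignments -/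

lemma Term.exists_bound (t : Term) : ∃ N, ∀ i, t.Mentions i → i < N := by
  induction t with
  | var k => exact ⟨k + 1, fun i h => by simp only [Term.Mentions] at h; omega⟩
  | zero | one => exact ⟨0, fun i h => h.elim⟩
  | add s t hs ht | mul s t hs ht =>
    obtain ⟨N, hN⟩ := hs
    obtain ⟨N', hN'⟩ := ht
    exact ⟨max N N', fun i h => h.elim (fun h => lt_max_of_lt_left (hN i h))
      fun h => lt_max_of_lt_right (hN' i h)⟩

lemma Formula.exists_bound (φ : Formula) : ∃ N, ∀ i, φ.MentionsNum i → i < N := by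
  induction φ with
  | eq s t | lt s t =>
    obtain ⟨N, hN⟩ := s.exists_bound
    obtain ⟨N', hN'⟩ := t.exists_bound
    exact ⟨max N N', fun i h => h.elim (fun h => lt_max_of_lt_left (hN i h))
      fun h => lt_max_of_lt_right (hN' i h)⟩
  | mem t j => exact t.exists_bound
  | neg φ ih | allSet j φ ih | exSet j φ ih => exact ih
  | and φ ψ hs ht | or φ ψ hs ht | imp φ ψ hs ht =>
    obtain ⟨N, hN⟩ := hs
    obtain ⟨N', hN'⟩ := ht
    exact ⟨max N N', fun i h => h.elim (fun h => lt_max_of_lt_left (hN i h))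
      fun h => lt_max_of_lt_right (hN' i h)⟩
  | all j φ ih | ex j φ ih =>
    obtain ⟨N, hN⟩ := ih
    exact ⟨max N (j + 1), fun i h => h.elim (fun h => by omega)
      fun h => lt_max_of_lt_left (hN i h)⟩

lemma Formula.sat_congr (M : L2Structure.{u}) {φ : Formula} {e e' : ℕ → M.Num}
    {E E' : ℕ → M.Sets} (he : ∀ i, φ.MentionsNum i → e i = e' i)
    (hE : ∀ j, φ.MentionsSet j → E j = E' j) : φ.Sat M e E ↔ φ.Sat M e' E' := by
  induction φ generalizing e e' E E' with
  | eq s t | lt s t =>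
    simp only [Formula.Sat]
    rw [Term.val_congr M fun i hi => he i (Or.inl hi), Term.val_congr M fun i hi => he i (Or.inr hi)]
  | mem t j =>
    simp only [Formula.Sat]
    rw [Term.val_congr M he, hE j rfl]
  | neg φ ih => exact not_congr (ih he hE)
  | and φ ψ ih ih' =>
    exact and_congr (ih (fun i hi => he i (Or.inl hi)) fun i hi => hE i (Or.inl hi))
      (ih' (fun i hi => he i (Or.inr hi)) fun i hi => hE i (Or.inr hi))
  | or φ ψ ih ih' =>
    exact or_congr (ih (fun i hi => he i (Or.inl hi)) fun i hi => hE i (Or.inl hi))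
      (ih' (fun i hi => he i (Or.inr hi)) fun i hi => hE i (Or.inr hi))
  | imp φ ψ ih ih' =>
    exact imp_congr (ih (fun i hi => he i (Or.inl hi)) fun i hi => hE i (Or.inl hi))
      (ih' (fun i hi => he i (Or.inr hi)) fun i hi => hE i (Or.inr hi))
  | all j φ ih =>
    refine forall_congr' fun a => ih (fun i hi => ?_) hE
    simp only [Function.update_apply, he i (Or.inr hi)]
  | ex j φ ih =>
    refine exists_congr fun a => ih (fun i hi => ?_) hE
    simp only [Function.update_apply, he i (Or.inr hi)]
  | allSet j φ ih =>
    refine forall_congr' fun a => ih he (fun i hi => ?_)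
    simp only [Function.update_apply, hE i (Or.inr hi)]
  | exSet j φ ih =>
    refine exists_congr fun a => ih he (fun i hi => ?_)
    simp only [Function.update_apply, hE i (Or.inr hi)]

section assign

variable {M : L2Structure.{u}} {k : ℕ}

lemma isTermFun_val (t : Term) (h : ∀ i, t.Mentions i → i < k) :
    IsTermFun k fun v : Fin k → M.Num => t.val M (assign v) :=
  ⟨t, fun i hi h' => hi.not_gt (h i h'), fun e => Term.val_congr M fun i hi => by
    simp [assign, h i hi]⟩

end assign

/-! ### Arithmetical comprehension from `Σ⁰₁` comprehension -/

section sigmaComp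

variable {M : L2Structure.{u}} {k : ℕ}

/-- `Σ⁰₁` comprehension in `M`, without number parameters. -/
class SigmaComp (M : L2Structure.{u}) : Prop extends ModelsRCA0 M where
  exists_set : ∀ R : M.Num → M.Num → Prop, Definable 2 (fun v => R (v 0) (v 1)) →
    ∃ S : M.Sets, ∀ a, M.mem a S ↔ ∃ b, R a b

/-- A definable relation is the set of codes of its tuples. -/
lemma Definable.exists_code [ModelsRCA0 M] {P : (Fin k → M.Num) → Prop} (hP : Definable k P) :
    ∃ S : M.Sets, ∀ v, M.mem (tcode k v) S ↔ P v := by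
  have h := (hP.reindex (ρ := Fin.natAdd 0) (Fin.natAdd_injective _ _)).code (R := fun _ => P)
  obtain ⟨S, hS⟩ := Definable.exists_set (k := 0) (R := fun _ z => ∃ x, z = tcode k x ∧ P x)
    h Fin.elim0
  refine ⟨S, fun v => (hS _).trans ⟨?_, fun h => ⟨v, rfl, h⟩⟩⟩
  rintro ⟨x, hx, h⟩
  rwa [tcode_inj.1 hx]

lemma Definable.subst [ModelsRCA0 M] {m : ℕ} {P : (Fin k → M.Num) → Prop} (hP : Definable k P)
    {f : Fin k → (Fin m → M.Num) → M.Num} (hf : ∀ i, IsTermFun m (f i)) :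
    Definable m fun v => P fun i => f i v := by
  obtain ⟨S, hS⟩ := hP.exists_code
  exact (Definable.mem (.tcode hf) S).congr fun v => hS _

variable [SigmaComp M]

/-- Under `Σ⁰₁` comprehension the definable relations are closed under number quantifiers: the
projection of a relation is replaced by the set of codes of its tuples, used as a parameter. -/
lemma Definable.ex {R : (Fin k → M.Num) → M.Num → Prop}
    (hR : Definable (k + 1) fun v => R (Fin.init v) (v (Fin.last k))) :
    Definable k fun v => ∃ a, R v a := by
  have hcode : Definable (1 + 1) fun v : Fin (1 + 1) → M.Num =>
      ∃ x, v (Fin.last 1) = tcode k x ∧ R x (Fin.init v 0) := by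
    refine Definable.code (R := fun w x => R x (w 0)) ?_
    let ρ : Fin (k + 1) → Fin (1 + k) := Fin.snoc (Fin.natAdd 1) 0
    have hρ : ρ.Injective := by
      intro i j hij
      induction i using Fin.lastCases <;> induction j using Fin.lastCases <;>
        simp [ρ, Fin.ext_iff] at hij ⊢ <;> omega
    refine (hR.reindex hρ).congr fun v => iff_of_eq (congrArg₂ R (funext fun i => ?_) ?_)
    · simp [ρ, Fin.init]
    · simp [ρ]; rfl
  obtain ⟨S, hS⟩ := SigmaComp.exists_set (M := M) (fun z a => ∃ x, z = tcode k x ∧ R x a)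
    (hcode.reindex (ρ := ![1, 0]) (by decide))
  refine (Definable.mem (.tcode fun i => .var i) S).congr fun v => ?_
  rw [hS]
  refine exists_congr fun a => ⟨?_, fun h => ⟨v, rfl, h⟩⟩
  rintro ⟨x, hx, h⟩
  rwa [show v = x from tcode_inj.1 hx]

lemma Definable.all {R : (Fin k → M.Num) → M.Num → Prop}
    (hR : Definable (k + 1) fun v => R (Fin.init v) (v (Fin.last k))) :
    Definable k fun v => ∀ a, R v a :=
  (Definable.ex (R := fun v a => ¬ R v a) hR.not).not.congr fun v => by push Not; rfl

lemma Definable.ex_block {n : ℕ} {R : (Fin k → M.Num) → (Fin n → M.Num) → Prop}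
    (hR : Definable (k + n) fun v => R (fun i => v (Fin.castAdd n i)) fun i => v (Fin.natAdd k i)) :
    Definable k fun v => ∃ x : Fin n → M.Num, R v x := by
  -- a common bound on the entries reduces this to bounded quantifiers
  have h : Definable k fun v => ∃ b, ∃ x : Fin n → M.Num, (∀ i, x i < b) ∧ R v x := by
    refine Definable.ex (Definable.bex_block (R := fun v x => R (Fin.init v) x) (.var _) ?_)
    let ρ : Fin (k + n) → Fin (k + 1 + n) :=
      Fin.addCases (fun i => Fin.castAdd n i.castSucc) (fun i => Fin.natAdd (k + 1) i)
    have hρ : ρ.Injective := by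
      intro i j hij
      induction i using Fin.addCases <;> induction j using Fin.addCases <;>
        simp [ρ, Fin.ext_iff] at hij ⊢ <;> omega
    refine (hR.reindex hρ).congr fun v => ?_
    simp only [ρ, Fin.addCases_left, Fin.addCases_right]
    rfl
  refine h.congr fun v => ⟨fun ⟨_, x, _, h⟩ => ⟨x, h⟩, fun ⟨x, h⟩ => ⟨tcode n x + 1, x, ?_, h⟩⟩
  exact fun i => num_lt_add_one.2 (le_tcode x i)

/-- Strong induction for definable predicates. -/
lemma Definable.strong_induction {R : (Fin k → M.Num) → M.Num → Prop}
    (hR : Definable (k + 1) fun v => R (Fin.init v) (v (Fin.last k))) (v : Fin k → M.Num)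
    (hs : ∀ a, (∀ b < a, R v b) → R v a) (a : M.Num) : R v a := by
  refine hs a (Definable.induction (R := fun v a => ∀ b < a, R v b) (.ball (.var _) ?_) v ?_ ?_ a)
  · let ρ : Fin (k + 1) → Fin (k + 1 + 1) := Fin.snoc (fun i => i.castSucc.castSucc) (Fin.last _)
    refine (hR.subst (f := fun i w => w (ρ i)) fun i => .var _).congr fun w =>
      iff_of_eq (congrArg₂ R (funext fun i => ?_) ?_)
    · simp [ρ, Fin.init]
    · simp [ρ]
  · exact fun b hb => absurd hb (num_zero_le b).not_gt
  · intro a ha b hb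
    rcases (num_lt_add_one.1 hb).lt_or_eq with h | rfl
    · exact ha b h
    · exact hs b ha

lemma definable_update (P : (Fin k → M.Num) → Prop) (hP : Definable k P) (i : Fin k) :
    Definable (k + 1) fun v => P (Function.update (Fin.init v) i (v (Fin.last k))) := by
  refine (hP.subst (f := fun j w => w (Function.update Fin.castSucc i (Fin.last k) j))
    fun j => .var _).congr fun w => iff_of_eq (congrArg P (funext fun j => ?_))
  rcases eq_or_ne j i with rfl | h
  · simp
  · simp [h, Fin.init]

/-- Under `Σ⁰₁` comprehension every arithmetical formula defines a definable relation. -/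
lemma definable_sat {φ : Formula} (hφ : φ.IsArithmetical) (E : ℕ → M.Sets)
    (hk : ∀ i, φ.MentionsNum i → i < k) :
    Definable k fun v : Fin k → M.Num => φ.Sat M (assign v) E := by
  induction φ with
  | eq s t =>
    exact .eq (isTermFun_val s fun i hi => hk i (Or.inl hi))
      (isTermFun_val t fun i hi => hk i (Or.inr hi))
  | lt s t =>
    exact .lt (isTermFun_val s fun i hi => hk i (Or.inl hi))
      (isTermFun_val t fun i hi => hk i (Or.inr hi))
  | mem t j => exact .mem (isTermFun_val t hk) _
  | neg φ ih => exact (ih hφ hk).not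
  | and φ ψ ih ih' =>
    exact (ih hφ.1 fun i hi => hk i (Or.inl hi)).and (ih' hφ.2 fun i hi => hk i (Or.inr hi))
  | or φ ψ ih ih' =>
    exact (ih hφ.1 fun i hi => hk i (Or.inl hi)).or (ih' hφ.2 fun i hi => hk i (Or.inr hi))
  | imp φ ψ ih ih' =>
    exact (ih hφ.1 fun i hi => hk i (Or.inl hi)).imp (ih' hφ.2 fun i hi => hk i (Or.inr hi))
  | all j φ ih =>
    have := ih hφ fun i hi => hk i (Or.inr hi)
    refine (Definable.all (R := fun v a =>
      φ.Sat M (assign (Function.update v ⟨j, hk j (Or.inl rfl)⟩ a)) E)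
      (definable_update _ this _)).congr fun v => ?_
    simp only [Formula.Sat, assign_update v j (hk j (Or.inl rfl))]
  | ex j φ ih =>
    have := ih hφ fun i hi => hk i (Or.inr hi)
    refine (Definable.ex (R := fun v a =>
      φ.Sat M (assign (Function.update v ⟨j, hk j (Or.inl rfl)⟩ a)) E)
      (definable_update _ this _)).congr fun v => ?_
    simp only [Formula.Sat, assign_update v j (hk j (Or.inl rfl))]
  | allSet j φ => exact hφ.elim
  | exSet j φ => exact hφ.elim

theorem models_arithmeticalComprehension {φ : Formula} (h : ArithmeticalComprehension φ) :
    M.Models φ := by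
  obtain ⟨φ, i, j, hφ, hj⟩ := h
  intro e E
  obtain ⟨N, hN⟩ := φ.exists_bound
  let k := max N (i + 1)
  have hi : i < k := lt_max_of_lt_right (Nat.lt_succ_self i)
  obtain ⟨S, hS⟩ := Definable.exists_set
    (R := fun v a => φ.Sat M (assign (Function.update v ⟨i, hi⟩ a)) E)
    (definable_update _ (definable_sat (k := k) hφ E fun i hi => lt_max_of_lt_left (hN i hi))
      ⟨i, hi⟩) (fun i => e i)
  refine ⟨S, fun a => ?_⟩
  have := hS a
  rw [← assign_update, Formula.sat_congr M (e' := Function.update e i a)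
    (E' := Function.update E j S)] at this
  · simp only [Formula.iff, Formula.Sat, Term.val, Function.update_self]
    exact ⟨this.1, this.2⟩
  · intro l hl
    have : l < k := lt_max_of_lt_left (hN l hl)
    simp [Function.update_apply, assign, this]
  · intro l hl
    exact (Function.update_of_ne (by rintro rfl; exact hj hl) _ _).symm

end sigmaComp

lemma Formula.IsSigma00.isArithmetical {φ : Formula} (h : φ.IsSigma00) : φ.IsArithmetical := by
  induction h with
  | eq | lt | mem => exact trivial
  | neg _ ih => exact ih
  | and _ _ ih ih' | or _ _ ih ih' | imp _ _ ih ih' => exact ⟨ih, ih'⟩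
  | ball _ _ _ _ ih | bex _ _ _ _ ih => exact ⟨trivial, ih⟩

theorem sigmaComp_of_models_ACA0 {M : L2Structure.{u}} (h : ∀ ψ ∈ ACA0, M.Models ψ) :
    SigmaComp M where
  models ψ hψ := h ψ (Or.inl hψ)
  exists_set R hR := by
    obtain ⟨φ, hφ, E, hE⟩ := hR
    let θ := φ.rename id Nat.succ
    have hfresh : ¬ θ.MentionsSet 0 := fun h0 => by
      obtain ⟨j, hj⟩ := Formula.mentionsSet_rename h0
      exact Nat.succ_ne_zero j hj
    have := h _ (Or.inr (.mk (.ex 1 θ) 0 0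
      (hφ.rename Function.injective_id _).isArithmetical hfresh)) (fun _ => M.zero)
      (fun j => E (j - 1))
    obtain ⟨S, hS⟩ := this
    refine ⟨S, fun a => ?_⟩
    have h' := hS a
    have hupd : Function.update (fun j => E (j - 1)) 0 S ∘ Nat.succ = E := by
      funext j; simp
    simp only [Formula.Sat, Formula.iff, hφ.sat_rename M Function.injective_id, θ,
      Function.comp_id, hupd, hE, Term.val, Function.update_self] at h'
    simpa using iff_of_eq (propext ⟨h'.1, h'.2⟩)

/-! ### The meaning of `D_n IP` in a structure -/

section families

variable {M : L2Structure.{u}}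

/-- The set `A_i` of the family coded by `A`. -/
def row (A : M.Sets) (i : M.Num) : Set M.Num := {x | M.mem (npair x i) A}

/-- The family `B` is a subfamily of `A`. -/
def IsSubfamily (B A : M.Sets) : Prop := ∀ i, ∃ j, row B i = row A j

/-- The family `A` has the `D_n` intersection property. -/
def HasD (n : ℕ) (A : M.Sets) : Prop :=
  ∀ x : Fin n → M.Num, Function.Injective (fun k => row A (x k)) → ¬ ∃ y, ∀ k, y ∈ row A (x k)

lemma sat_rowEq {k a b : ℕ} {i j : Term} (hi : ¬ i.Mentions k) (hj : ¬ j.Mentions k)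
    (e : ℕ → M.Num) (E : ℕ → M.Sets) :
    (rowEq k a i b j).Sat M e E ↔ row (E a) (i.val M e) = row (E b) (j.val M e) := by
  have h : ∀ {t : Term}, ¬ t.Mentions k → ∀ x, t.val M (Function.update e k x) = t.val M e :=
    fun {t} ht x => Term.val_congr M fun l hl =>
      Function.update_of_ne (by rintro rfl; exact ht hl) _ _
  rw [Set.ext_iff]
  refine forall_congr' fun x => ?_
  simp only [Formula.iff, Formula.Sat, memRow, pair, Term.val, Function.update_self, h hi, h hj]
  exact ⟨fun h => ⟨h.1, h.2⟩, fun h => ⟨h.1, h.2⟩⟩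

lemma sat_subfamily (a b : ℕ) (e : ℕ → M.Num) (E : ℕ → M.Sets) :
    (subfamily b a).Sat M e E ↔ IsSubfamily (E b) (E a) := by
  refine forall_congr' fun i => exists_congr fun j => ?_
  rw [sat_rowEq (by simp [Term.Mentions]) (by simp [Term.Mentions])]
  simp [Term.val]

lemma sat_conj (l : List Formula) (e : ℕ → M.Num) (E : ℕ → M.Sets) :
    (conj l).Sat M e E ↔ ∀ φ ∈ l, φ.Sat M e E := by
  induction l with
  | nil => simp [conj, Formula.Sat]
  | cons φ l ih => simp [conj, Formula.Sat, ih]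

lemma sat_allBlock (n : ℕ) (φ : Formula) (e : ℕ → M.Num) (E : ℕ → M.Sets) :
    (allBlock n φ).Sat M e E ↔ ∀ x : Fin n → M.Num,
      φ.Sat M (fun i => if h : i < n then x ⟨i, h⟩ else e i) E := by
  induction n generalizing φ with
  | zero => simp [allBlock]
  | succ n ih =>
    rw [allBlock, ih]
    have key : ∀ (x : Fin n → M.Num) (a : M.Num),
        Function.update (fun i => if h : i < n then x ⟨i, h⟩ else e i) n a =
        fun i => if h : i < n + 1 then (Fin.snoc x a : Fin (n + 1) → M.Num) ⟨i, h⟩ else e i := by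
      intro x a
      funext i
      rcases lt_trichotomy i n with h | rfl | h
      · simp [h.ne, h, Nat.lt_succ_of_lt h, Fin.snoc]
      · simp [Fin.snoc]
      · simp [h.ne', h.not_gt, show ¬ i < n + 1 by omega]
    constructor
    · intro H x
      have := H (Fin.init x) (x (Fin.last n))
      rwa [key, Fin.snoc_init_self] at this
    · intro H x a
      rw [key]
      exact H _

lemma sat_hasDn (n a : ℕ) (e : ℕ → M.Num) (E : ℕ → M.Sets) :
    (hasDn n a).Sat M e E ↔ HasD n (E a) := by
  rw [hasDn, sat_allBlock]
  refine forall_congr' fun x => imp_congr ?_ (not_congr (exists_congr fun y => ?_))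
  · rw [sat_conj]
    simp only [List.mem_flatMap, List.mem_map, List.mem_range]
    constructor
    · intro H k l hkl
      wlog h : k < l generalizing k l
      · rcases (not_lt.1 h).lt_or_eq with h | h
        · exact (this hkl.symm h).symm
        · exact h.symm
      have := H _ ⟨l, l.2, k, h, rfl⟩
      simp only [Formula.Sat] at this
      rw [sat_rowEq (by simp [Term.Mentions]; omega) (by simp [Term.Mentions]; omega)] at this
      exact absurd (by simpa [Term.val] using hkl) this
    · rintro H _ ⟨l, hl, k, hk, rfl⟩
      simp only [Formula.Sat]
      rw [sat_rowEq (by simp [Term.Mentions]; omega) (by simp [Term.Mentions]; omega)]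
      intro h
      have := @H ⟨k, hk.trans hl⟩ ⟨l, hl⟩ (by simpa [Term.val, hl, hk.trans hl] using h)
      exact hk.ne (Fin.ext_iff.1 this)
  · rw [sat_conj]
    simp only [List.mem_map, List.mem_range, forall_exists_index, and_imp,
      forall_apply_eq_imp_iff₂, memRow, Formula.Sat, pair, Term.val, Function.update_self]
    constructor
    · intro H k
      have := H k k.2
      simp only [Function.update_of_ne k.2.ne, dif_pos k.2] at this
      exact this
    · intro H k hk
      simp only [Function.update_of_ne hk.ne, dif_pos hk]
      exact H ⟨k, hk⟩

/-- `B` is a maximal subfamily of `A` with the `D_n` intersection property. -/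
structure IsMaximalD (n : ℕ) (B A : M.Sets) : Prop where
  isSubfamily : IsSubfamily B A
  hasD : HasD n B
  maximal : ∀ C, IsSubfamily C A → HasD n C → IsSubfamily B C → IsSubfamily C B

theorem models_DnIP (n : ℕ) : M.Models (DnIP n) ↔
    ∀ A : M.Sets, (∃ i, (row A i).Nonempty) → ∃ B, IsMaximalD n B A := by
  have : Nonempty (ℕ → M.Num) := ⟨fun _ => M.zero⟩
  have : Nonempty (ℕ → M.Sets) := ⟨fun _ => Classical.arbitrary _⟩
  have key : ∀ (e : ℕ → M.Num) (E : ℕ → M.Sets), (DnIP n).Sat M e E ↔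
      ∀ A : M.Sets, (∃ i, (row A i).Nonempty) → ∃ B, IsMaximalD n B A := by
    intro e E
    refine forall_congr' fun A => imp_congr ?_ (exists_congr fun B => ?_)
    · simp [nontrivialFamily, memRow, pair, Formula.Sat, Term.val, Set.Nonempty, row]
      rfl
    · simp only [maximalSubfamily, Formula.Sat, sat_subfamily, sat_hasDn]
      simp
      exact ⟨fun h => ⟨h.1, h.2.1, h.2.2⟩, fun h => ⟨h.1, h.2, h.3⟩⟩
  simp only [L2Structure.Models, key, forall_const]

end families

/-! ### `Σ⁰₁` comprehension from `D_n IP` -/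

section reversal

variable {M : L2Structure.{u}}

lemma IsTermFun.natCast [ModelsRCA0 M] {k : ℕ} (n : ℕ) :
    IsTermFun k fun _ : Fin k → M.Num => (n : M.Num) := by
  induction n with
  | zero => simpa using IsTermFun.zero
  | succ n ih => simpa using ih.succ

variable [ModelsRCA0 M]

lemma Definable.exists_family {k : ℕ} {W : (Fin k → M.Num) → M.Num → M.Num → Prop}
    (hW : Definable (k + 2) fun v =>
      W (Fin.init (Fin.init v)) (Fin.init v (Fin.last k)) (v (Fin.last (k + 1))))
    (v : Fin k → M.Num) : ∃ A : M.Sets, ∀ i x, x ∈ row A i ↔ W v i x := by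
  obtain ⟨A, hA⟩ := Definable.exists_set
    (R := fun v z => ∃ i < z + 1, ∃ x < z + 1, z = npair x i ∧ W v i x)
    (.bex (.succ (.var _)) (.bex (.succ (.var (Fin.last k).castSucc))
      (.and (.eq (.var (Fin.last k).castSucc.castSucc)
        (.npair (.var (Fin.last _)) (.var (Fin.last _).castSucc))) (by
        let f : Fin (k + 2) → Fin (k + 1 + 1 + 1) := Fin.snoc (Fin.snoc
          (fun i => i.castSucc.castSucc.castSucc) (Fin.last _).castSucc : Fin (k + 1) → _)
          (Fin.last _)
        refine (hW.subst (f := fun i w => w (f i)) fun i => .var _).congr fun w => ?_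
        have h : Fin.init (Fin.init fun i => w (f i)) = Fin.init (Fin.init (Fin.init w)) := by
          funext i; simp [f, Fin.init]
        rw [h]
        simp [f, Fin.init])))) v
  refine ⟨A, fun i x => (hA _).trans ⟨?_, fun h => ⟨i, ?_, x, ?_, rfl, h⟩⟩⟩
  · rintro ⟨i', -, x', -, h, hW⟩
    obtain ⟨rfl, rfl⟩ := npair_inj.1 h
    exact hW
  · exact num_lt_add_one.2 (right_le_npair _ _)
  · exact num_lt_add_one.2 (left_le_npair _ _)

/-- The family consisting of the set `A_c` followed by the sets of the family `B`. -/
lemma exists_cons (A B : M.Sets) (c : M.Num) :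
    ∃ C : M.Sets, row C 0 = row A c ∧ ∀ i, row C (i + 1) = row B i := by
  obtain ⟨C, hC⟩ := Definable.exists_family (k := 1)
    (W := fun v i x => (i = 0 ∧ M.mem (npair x (v 0)) A) ∨
      ∃ j < i, i = j + 1 ∧ M.mem (npair x j) B)
    (.or (.and (.eq (.var 1) .zero) (.mem (.npair (.var 2) (.var 0)) A))
      (.bex (.var 1) (.and (.eq (.var (k := 4) 1) (.succ (.var 3)))
        (.mem (.npair (.var 2) (.var 3)) B)))) ![c]
  refine ⟨C, Set.ext fun x => (hC _ _).trans ?_, fun i => Set.ext fun x => (hC _ _).trans ?_⟩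
  · simp [fun j : M.Num => (num_zero_le j).not_gt]; rfl
  · simp; rfl

/-- The family used to decide a `Σ⁰₁` set `{i : ∃ s, R i s}`. The set with index `(i, l)` has the
element `(i, (0, l))` of its own and, for every witness `s` of `R i s`, the element
`(i, (s + 1, 0))`, which it shares with all sets with index `(i, l')`. -/
lemma exists_witness_family {R : M.Num → M.Num → Prop} (hR : Definable 2 fun v => R (v 0) (v 1)) :
    ∃ A : M.Sets, ∀ c x, x ∈ row A c ↔ ∃ i l, c = npair i l ∧
      (x = npair i (npair 0 l) ∨ ∃ s, x = npair i (npair (s + 1) 0) ∧ R i s) := by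
  obtain ⟨A, hA⟩ := Definable.exists_family (k := 0)
    (W := fun _ c x => ∃ i < c + 1, ∃ l < c + 1, c = npair i l ∧
      (x = npair i (npair 0 l) ∨ ∃ s < x + 1, x = npair i (npair (s + 1) 0) ∧ R i s))
    (.bex (.succ (.var 0)) (.bex (.succ (.var (k := 3) 0)) (.and
      (.eq (.var (k := 4) 0) (.npair (.var 2) (.var 3))) (.or
        (.eq (.var (k := 4) 1) (.npair (.var 2) (.npair .zero (.var 3))))
        (.bex (.succ (.var (k := 4) 1)) (.and
          (.eq (.var (k := 5) 1) (.npair (.var 2) (.npair (.succ (.var 4)) .zero)))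
          (hR.reindex (ρ := ![2, 4]) (by decide)))))))) Fin.elim0
  refine ⟨A, fun c x => (hA c x).trans ⟨?_, ?_⟩⟩
  · rintro ⟨i, -, l, -, h, h' | ⟨s, -, h'⟩⟩
    · exact ⟨i, l, h, Or.inl h'⟩
    · exact ⟨i, l, h, Or.inr ⟨s, h'⟩⟩
  · rintro ⟨i, l, h, h'⟩
    refine ⟨i, ?_, l, ?_, h, h'.imp_right ?_⟩
    · rw [h, num_lt_add_one]; exact left_le_npair _ _
    · rw [h, num_lt_add_one]; exact right_le_npair _ _
    · rintro ⟨s, h, hs⟩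
      refine ⟨s, ?_, h, hs⟩
      rw [h, num_lt_add_one]
      exact le_self_add.trans ((left_le_npair _ _).trans (right_le_npair _ _))

/-- A set of `A` that has a point of its own and, apart from repetitions, meets no other set of `A`
in any of its points occurs in every maximal subfamily. -/
lemma IsMaximalD.exists_row_eq {n : ℕ} (hn : 2 ≤ n) {A B : M.Sets} (hB : IsMaximalD n B A)
    {c : M.Num} (hc : ∀ d, ∀ y ∈ row A c, y ∈ row A d → row A d = row A c) :
    ∃ j, row A c = row B j := by
  obtain ⟨C, hC0, hC⟩ := exists_cons A B c
  have hCA : IsSubfamily C A := fun i => by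
    rcases num_eq_zero_or_succ i with rfl | ⟨i, rfl⟩
    · exact ⟨c, hC0⟩
    · rw [hC]; exact hB.isSubfamily i
  have hCD : HasD n C := by
    rintro x hx ⟨y, hy⟩
    by_cases h : ∃ k, row C (x k) = row A c
    · obtain ⟨k, hk⟩ := h
      have : Nontrivial (Fin n) := Fin.nontrivial_iff_two_le.2 hn
      obtain ⟨l, hl⟩ := exists_ne k
      obtain ⟨d, hd⟩ := hCA (x l)
      refine hl (hx ?_)
      simp only [hk, hd]
      exact hc d y (hk ▸ hy k) (hd ▸ hy l)
    · push Not at h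
      have : ∀ k, ∃ j, x k = j + 1 := fun k => by
        rcases num_eq_zero_or_succ (x k) with h0 | h1
        · exact absurd hC0 (h0 ▸ h k)
        · exact h1
      choose z hz using this
      have hrow : ∀ k, row C (x k) = row B (z k) := fun k => by rw [hz, hC]
      simp only [hrow] at hx hy
      exact hB.hasD z hx ⟨y, hy⟩
  obtain ⟨j, hj⟩ := hB.maximal C hCA hCD (fun i => ⟨i + 1, (hC i).symm⟩) 0
  exact ⟨j, hC0 ▸ hj⟩

theorem sigmaComp_of_models_DnIP {n : ℕ} (hn : 2 ≤ n) (h : M.Models (DnIP n)) : SigmaComp M where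
  exists_set R hR := by
    obtain ⟨A, hA⟩ := exists_witness_family hR
    have hown : ∀ i l, npair i (npair 0 l) ∈ row A (npair i l) := fun i l =>
      (hA _ _).2 ⟨i, l, rfl, Or.inl rfl⟩
    have hown' : ∀ i l c, npair i (npair 0 l) ∈ row A c → c = npair i l := by
      intro i l c hc
      obtain ⟨i', l', rfl, h | ⟨s, h, -⟩⟩ := (hA _ _).1 hc
      · simp only [npair_inj, true_and] at h
        rw [h.1, h.2]
      · exact absurd (npair_inj.1 (npair_inj.1 h).2).1.symm (by simp)
    obtain ⟨B, hB⟩ := (models_DnIP n).1 h A ⟨_, _, hown 0 0⟩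
    -- `i` has no witness iff all the sets with indices `(i, 0), …, (i, n - 1)` are in `B`
    obtain ⟨S, hS⟩ := Definable.exists_set_of_delta (k := 0) (R := fun _ i s => R i s)
      (R' := fun _ i w => ∀ l : Fin n, ∃ j < w, npair i (npair 0 ((l : ℕ) : M.Num)) ∈ row B j)
      hR (.forall_fin fun l => .bex (.var 1)
        (.mem (.npair (.npair (.var 0) (.npair .zero (.natCast l))) (.var 2)) B))
      Fin.elim0 fun i => by
        constructor
        · rintro ⟨s, hs⟩ ⟨w, hw⟩
          choose j hj hj' using hw
          have hrow : ∀ l, row B (j l) = row A (npair i ((l : ℕ) : M.Num)) := fun l => by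
            obtain ⟨c, hc⟩ := hB.isSubfamily (j l)
            rw [hc, ← hown' _ _ c (hc ▸ hj' l)]
          refine hB.hasD j (fun l l' hll' => ?_) ⟨npair i (npair (s + 1) 0), fun l => ?_⟩
          · simp only [hrow] at hll'
            have := hown' _ _ _ (hll' ▸ hown i ((l : ℕ) : M.Num))
            exact Fin.ext (Nat.cast_injective (npair_inj.1 this).2.symm)
          · rw [hrow, hA]
            exact ⟨i, _, rfl, Or.inr ⟨s, rfl, hs⟩⟩
        · intro hw
          by_contra hs
          refine hw ?_
          have : ∀ l : Fin n, ∃ j, row A (npair i ((l : ℕ) : M.Num)) = row B j := fun l => by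
            refine hB.exists_row_eq hn fun d y hy hd => ?_
            obtain ⟨i', l', h, hy | ⟨s, -, hs'⟩⟩ := (hA _ _).1 hy
            · obtain ⟨rfl, rfl⟩ := npair_inj.1 h
              rw [hown' _ _ d (hy ▸ hd)]
            · exact absurd ⟨s, (npair_inj.1 h).1 ▸ hs'⟩ hs
          choose j hj using this
          have hne : (Finset.univ : Finset (Fin n)).Nonempty := ⟨⟨0, by omega⟩, Finset.mem_univ _⟩
          obtain ⟨l₀, -, hl₀⟩ := Finset.exists_max_image Finset.univ j hne
          exact ⟨j l₀ + 1, fun l => ⟨j l, num_lt_add_one.2 (hl₀ l (Finset.mem_univ l)),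
            hj l ▸ hown i _⟩⟩
    exact ⟨S, hS⟩

end reversal

/-! ### Finite sets coded by numbers, and definition by recursion -/

section coding

variable {M : L2Structure.{u}}

/-- `i` is in the finite set coded by the pair `m`, `a`, in the manner of Gödel's `β` function:
`1 + (i + 1) m` divides `a`. -/
def InCode [ModelsRCA0 M] (m a i : M.Num) : Prop := 1 + (i + 1) * m ∣ a

/-- `a` is a unit modulo `p`; the congruence `u a ≡ 1` is written without subtraction. -/
def IsUnitMod [ModelsRCA0 M] (p a : M.Num) : Prop := ∃ u v w, u * a + v * p = 1 + w * p

section basic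

variable [ModelsRCA0 M]

lemma isUnitMod_one (p : M.Num) : IsUnitMod p 1 := ⟨1, 0, 0, by ring⟩

lemma IsUnitMod.mul {p a b : M.Num} (ha : IsUnitMod p a) (hb : IsUnitMod p b) :
    IsUnitMod p (a * b) := by
  obtain ⟨u, v, w, h⟩ := ha
  obtain ⟨u', v', w', h'⟩ := hb
  exact ⟨u * u', u * a * v' + v * u' * b + v * v' * p, w + w' + w * w' * p, by grind⟩

lemma IsUnitMod.not_dvd {p a : M.Num} (hp : 1 < p) (h : IsUnitMod p a) : ¬ p ∣ a := by
  rintro ⟨q, rfl⟩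
  obtain ⟨u, v, w, h⟩ := h
  have h1 : p * w < p * (u * q + v) := by
    have : p * (u * q + v) = 1 + p * w := by linear_combination h
    rw [this, add_comm]
    exact lt_add_one _
  obtain ⟨d, hd⟩ := exists_add_of_le (lt_of_mul_lt_mul_left h1 (num_zero_le p)).le
  have h2 : p * d = 1 := by
    refine add_left_cancel (a := p * w) ?_
    rw [← mul_add, ← hd]
    linear_combination h
  rcases num_eq_zero_or_succ d with rfl | ⟨d, rfl⟩
  · simp at h2
  · have : p ≤ p * (d + 1) := le_mul_of_one_le_right' le_add_self
    exact absurd (h2 ▸ this) hp.not_ge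

/-- Distinct moduli `1 + (i + 1) m` and `1 + (j + 1) m` are coprime, if `i - j` divides `m`. -/
lemma isUnitMod_modulus {l m i j : M.Num} (hm : ∀ d, 0 < d → d ≤ l → d ∣ m) (hi : i < l)
    (hj : j < l) (hij : i ≠ j) : IsUnitMod (1 + (i + 1) * m) (1 + (j + 1) * m) := by
  have key : ∀ {i j : M.Num}, i < j → j < l → ∃ d t, j = i + d ∧ m = d * t := fun {i j} h hj => by
    obtain ⟨d, rfl⟩ := exists_add_of_le h.le
    obtain ⟨t, ht⟩ := hm d (pos_iff_ne_zero.2 (by rintro rfl; simp at h)) (le_add_self.trans hj.le)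
    exact ⟨d, t, rfl, ht⟩
  -- With `p = 1 + c` the modulus, `c = (i + 1) m` is `-1` modulo `p`, and
  -- `± (1 + (j + 1) m) * t (i + 1)²` is `c²`.
  rcases hij.lt_or_gt with h | h
  · obtain ⟨d, t, rfl, ht⟩ := key h hj
    refine ⟨t * (i + 1) * (i + 1), 2, t * (i + 1) * (i + 1) + (1 + (i + 1) * m), ?_⟩
    have : t * (i + 1) * (i + 1) * (d * m) = ((i + 1) * m) * ((i + 1) * m) := by
      nth_rewrite 2 [ht]; ring
    linear_combination this
  · obtain ⟨d, t, rfl, ht⟩ := key h hi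
    generalize hc : (j + d + 1) * m = c
    refine ⟨t * (j + d + 1) * (j + d + 1) * c, c * c + 1,
      t * (j + d + 1) * (j + d + 1) * c + c, ?_⟩
    have h1 : t * (j + d + 1) * (j + d + 1) * c * (d * m) = c * c * c := by
      calc _ = (d * t) * ((j + d + 1) * ((j + d + 1) * m)) * c := by ring
        _ = _ := by rw [hc, ← ht, ← hc]; ring
    have h2 : (1 + c) = (1 + (j + 1) * m) + d * m := by rw [← hc]; ring
    refine add_right_cancel (b := c * c * c) ?_
    nth_rewrite 1 [← h1]
    calc _ = t * (j + d + 1) * (j + d + 1) * c * ((1 + (j + 1) * m) + d * m) +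
          (c * c + 1) * (1 + c) := by ring
      _ = _ := by rw [← h2]; ring

end basic

variable [SigmaComp M] {k : ℕ}

lemma Definable.dvd {f g : (Fin k → M.Num) → M.Num} (hf : IsTermFun k f) (hg : IsTermFun k g) :
    Definable k fun v => f v ∣ g v :=
  .ex (.eq hg.weaken (hf.weaken.mul (.var _)))

lemma Definable.inCode {f g h : (Fin k → M.Num) → M.Num} (hf : IsTermFun k f)
    (hg : IsTermFun k g) (hh : IsTermFun k h) :
    Definable k fun v => InCode (f v) (g v) (h v) :=
  .dvd (.add .one (.mul hh.succ hf)) hg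

lemma Definable.isUnitMod {f g : (Fin k → M.Num) → M.Num} (hf : IsTermFun k f)
    (hg : IsTermFun k g) : Definable k fun v => IsUnitMod (f v) (g v) :=
  .ex (.ex (.ex (.eq
    (.add (.mul (.var (Fin.last k).castSucc.castSucc) hg.weaken.weaken.weaken)
      (.mul (.var (Fin.last (k + 1)).castSucc) hf.weaken.weaken.weaken))
    (.add .one (.mul (.var (Fin.last (k + 2))) hf.weaken.weaken.weaken)))))

lemma exists_common_multiple (l : M.Num) : ∃ m, 0 < m ∧ ∀ d, 0 < d → d ≤ l → d ∣ m := by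
  refine Definable.induction (k := 0)
    (R := fun _ l => ∃ m, 0 < m ∧ ∀ d, 0 < d → ¬ l < d → d ∣ m) ?_ Fin.elim0 ?_ ?_ l |>.imp
    fun m hm => ⟨hm.1, fun d h h' => hm.2 d h h'.not_gt⟩
  · exact .ex (.and (.lt .zero (.var (k := 2) 1)) (.all (.imp (.lt .zero (.var (k := 3) 2))
      (.imp (.not (.lt (.var (k := 3) 0) (.var 2))) (.dvd (.var 2) (.var 1))))))
  · exact ⟨1, one_pos, fun d h h' => absurd h h'⟩
  · rintro l ⟨m, hm, h⟩
    refine ⟨m * (l + 1), mul_pos hm (add_pos_of_nonneg_of_pos (num_zero_le l) one_pos),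
      fun d hd hdl => ?_⟩
    rcases (not_lt.1 hdl).lt_or_eq with h' | rfl
    · exact (h d hd (num_lt_add_one.1 h').not_gt).mul_right _
    · exact dvd_mul_left _ _

/-- Every initial segment of a set is coded by a pair of numbers. -/
theorem exists_inCode (X : M.Sets) (l : M.Num) :
    ∃ m a, ∀ i < l, InCode m a i ↔ M.mem i X := by
  obtain ⟨m, hm0, hm⟩ := exists_common_multiple l
  -- the product of the moduli `1 + (i + 1) m` with `i ∈ X`, `i < b`, by induction on `b`
  have h := Definable.induction (k := 2) (R := fun v b => ∃ a, ∀ i < v 0,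
    ((i < b ∧ M.mem i X) → InCode (v 1) a i) ∧
    (¬ (i < b ∧ M.mem i X) → IsUnitMod (1 + (i + 1) * v 1) a)) ?_ ![l, m] ?_ ?_ l
  · obtain ⟨a, ha⟩ := h
    refine ⟨m, a, fun i hi => ⟨fun h => ?_, fun h => (ha i hi).1 ⟨hi, h⟩⟩⟩
    by_contra hX
    refine ((ha i hi).2 fun h => hX h.2).not_dvd ?_ h
    exact lt_add_of_pos_right _ (mul_pos (add_pos_of_nonneg_of_pos (num_zero_le i) one_pos) hm0)
  · have hmem : Definable 5 fun v : Fin 5 → M.Num => v 4 < v 2 ∧ M.mem (v 4) X :=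
      .and (.lt (.var 4) (.var 2)) (.mem (.var 4) X)
    exact .ex (.ball (.var (k := 4) 0) (.and
      (hmem.imp (.inCode (.var 1) (.var 3) (.var 4)))
      (hmem.not.imp (.isUnitMod (.add .one (.mul (.succ (.var 4)) (.var 1))) (.var 3)))))
  · exact ⟨1, fun i _ => ⟨fun h => absurd h.1 (num_zero_le i).not_gt, fun _ => isUnitMod_one _⟩⟩
  · rintro b ⟨a, ha⟩
    have split : ∀ i, i < b + 1 ∧ i ≠ b → i < b := fun i h =>
      (num_lt_add_one.1 h.1).lt_of_ne h.2
    by_cases hbX : M.mem b X ∧ b < l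
    · refine ⟨a * (1 + (b + 1) * m), fun i hi => ⟨fun h => ?_, fun h => ?_⟩⟩
      · by_cases hib : i = b
        · exact hib ▸ dvd_mul_left _ _
        · exact ((ha i hi).1 ⟨split i ⟨h.1, hib⟩, h.2⟩).mul_right _
      · have hib : i ≠ b := by
          rintro rfl
          exact h ⟨lt_add_one i, hbX.1⟩
        exact ((ha i hi).2 fun h' => h ⟨h'.1.trans (lt_add_one b), h'.2⟩).mul
          (isUnitMod_modulus hm hi hbX.2 hib)
    · refine ⟨a, fun i hi => ?_⟩
      have : (i < b + 1 ∧ M.mem i X) ↔ (i < b ∧ M.mem i X) := by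
        refine ⟨fun h => ⟨split i ⟨h.1, ?_⟩, h.2⟩, fun h => ⟨h.1.trans (lt_add_one b), h.2⟩⟩
        rintro rfl
        exact hbX ⟨h.2, hi⟩
      rw [this]
      exact ha i hi

/-- Definition of a set `J` by recursion: whether `i ∈ J` is determined by `J ∩ [0, i)`. The
approximations to `J` below a number are coded by numbers, so that `J` is given by comprehension
for a formula that quantifies over these codes. -/
theorem exists_set_of_recursion {Φ : M.Num → (M.Num → Prop) → Prop}
    (hloc : ∀ i F G, (∀ j < i, F j ↔ G j) → (Φ i F ↔ Φ i G))
    (hdef : Definable 3 fun v : Fin 3 → M.Num => Φ (v 2) (InCode (v 0) (v 1))) :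
    ∃ J : M.Sets, ∀ i, M.mem i J ↔ Φ i fun j => M.mem j J := by
  let Good (m a l : M.Num) : Prop := ∀ i < l, InCode m a i ↔ Φ i (InCode m a)
  have good_def : ∀ {k : ℕ} {f g h : (Fin k → M.Num) → M.Num}, IsTermFun k f → IsTermFun k g →
      IsTermFun k h → Definable k fun v => Good (f v) (g v) (h v) := fun hf hg hh =>
    .ball hh (.iff (.inCode hf.weaken hg.weaken (.var _)) ((hdef.subst
      (f := ![_, _, _]) (by
        intro i
        fin_cases i
        exacts [hf.weaken, hg.weaken, .var (Fin.last _)])).congr fun v => Iff.rfl))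
  have good_mono : ∀ {m a l l'}, Good m a l → l' ≤ l → Good m a l' := fun h hl i hi =>
    h i (hi.trans_le hl)
  have unique : ∀ {m a m' a' l}, Good m a l → Good m' a' l →
      ∀ i < l, InCode m a i ↔ InCode m' a' i := by
    intro m a m' a' l h h'
    refine Definable.strong_induction (k := 5)
      (R := fun v i => i < v 4 → (InCode (v 0) (v 1) i ↔ InCode (v 2) (v 3) i)) ?_
      ![m, a, m', a', l] ?_
    · exact .imp (.lt (.var 5) (.var 4)) (.iff (.inCode (.var 0) (.var 1) (.var 5))
        (.inCode (.var 2) (.var 3) (.var 5)))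
    · intro i ih hi
      exact (h i hi).trans ((hloc i _ _ fun j hj => ih j hj (hj.trans hi)).trans (h' i hi).symm)
  have exist : ∀ l, ∃ m a, Good m a l := by
    refine Definable.induction (k := 0) (R := fun _ l => ∃ m a, Good m a l)
      (.ex (.ex (good_def (.var (k := 3) 1) (.var 2) (.var 0)))) Fin.elim0 ?_ ?_
    · exact ⟨0, 0, fun i hi => absurd hi (num_zero_le i).not_gt⟩
    · rintro l ⟨m, a, h⟩
      obtain ⟨X, hX⟩ := Definable.exists_set (k := 2)
        (R := fun v i => Φ i (InCode (v 0) (v 1))) hdef ![m, a]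
      obtain ⟨m', a', h'⟩ := exists_inCode X (l + 1)
      refine ⟨m', a', fun i hi => (h' i hi).trans ((hX i).trans (hloc i _ _ fun j hj => ?_))⟩
      exact (h j (hj.trans_le (num_lt_add_one.1 hi))).trans
        ((hX j).symm.trans (h' j (hj.trans hi)).symm)
  obtain ⟨J, hJ⟩ := Definable.exists_set (k := 0)
    (R := fun _ i => ∃ m a, Good m a (i + 1) ∧ InCode m a i)
    (.ex (.ex (.and (good_def (.var (k := 3) 1) (.var 2) (.succ (.var 0)))
      (.inCode (.var 1) (.var 2) (.var 0))))) Fin.elim0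
  refine ⟨J, fun i => ?_⟩
  obtain ⟨m, a, h⟩ := exist (i + 1)
  have hJ' : ∀ j < i + 1, M.mem j J ↔ InCode m a j := fun j hj => by
    have hj' : j + 1 ≤ i + 1 := by gcongr; exact num_lt_add_one.1 hj
    refine (hJ j).trans ⟨?_, fun hc => ⟨m, a, good_mono h hj', hc⟩⟩
    rintro ⟨m', a', hg, hc⟩
    exact (unique hg (good_mono h hj') j (lt_add_one j)).1 hc
  rw [hJ' i (lt_add_one i), h i (lt_add_one i)]
  exact hloc i _ _ fun j hj => (hJ' j (hj.trans (lt_add_one i))).symm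

end coding

/-! ### `D_n IP` from arithmetical comprehension -/

section greedy

variable {M : L2Structure.{u}}

/-- Among the sets `A_j` with `F j` and `j < i`, together with `A_i`, there are `n` distinct ones
with a common element: a greedy construction that has chosen `F` below `i` has to skip `i`. -/
def IsConflict [ModelsRCA0 M] (n : ℕ) (A : M.Sets) (i : M.Num) (F : M.Num → Prop) : Prop :=
  ∃ x : Fin n → M.Num, (∀ k, x k = i ∨ (x k < i ∧ F (x k))) ∧
    Function.Injective (fun k => row A (x k)) ∧ ∃ y, ∀ k, y ∈ row A (x k)

lemma isConflict_congr [ModelsRCA0 M] {n : ℕ} {A : M.Sets} {i : M.Num} {F G : M.Num → Prop}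
    (h : ∀ j < i, F j ↔ G j) : IsConflict n A i F ↔ IsConflict n A i G := by
  refine exists_congr fun x => and_congr (forall_congr' fun k => or_congr Iff.rfl ?_) Iff.rfl
  exact and_congr_right fun hk => h _ hk

variable [SigmaComp M]

lemma Definable.const {k : ℕ} (p : Prop) : Definable k fun _ : Fin k → M.Num => p := by
  by_cases h : p
  · exact (Definable.eq .zero .zero).congr fun _ => by simp [h]
  · exact (Definable.lt .zero .zero).congr fun _ => by simp [h]

lemma Definable.row_eq {k : ℕ} {f g : (Fin k → M.Num) → M.Num} (A : M.Sets)
    (hf : IsTermFun k f) (hg : IsTermFun k g) : Definable k fun v => row A (f v) = row A (g v) :=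
  (Definable.all (R := fun v x => M.mem (npair x (f v)) A ↔ M.mem (npair x (g v)) A)
    (.iff (.mem (.npair (.var _) hf.weaken) A) (.mem (.npair (.var _) hg.weaken) A))).congr
    fun _ => Set.ext_iff.symm

lemma definable_isConflict (n : ℕ) (A : M.Sets) :
    Definable 3 fun v : Fin 3 → M.Num => IsConflict n A (v 2) (InCode (v 0) (v 1)) := by
  have hx : ∀ k : Fin n, IsTermFun (3 + n) fun v : Fin (3 + n) → M.Num => v (Fin.natAdd 3 k) :=
    fun k => .var _
  have hv : ∀ i : Fin 3, IsTermFun (3 + n) fun v : Fin (3 + n) → M.Num => v (Fin.castAdd n i) :=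
    fun i => .var _
  refine .ex_block (.and (.forall_fin fun k => ?_) (.and ?_ ?_))
  · exact .or (.eq (hx k) (hv 2)) (.and (.lt (hx k) (hv 2)) (.inCode (hv 0) (hv 1) (hx k)))
  · exact .forall_fin fun k => .forall_fin fun l => .imp (.row_eq A (hx k) (hx l)) (.const _)
  · exact .ex (.forall_fin fun k => .mem (.npair (.var _) (hx k).weaken) A)

/-- Every family has a maximal subfamily with the `D_n` intersection property, obtained by keeping
each set that is in no conflict with the sets kept before it. -/
theorem exists_isMaximalD {n : ℕ} (hn : 2 ≤ n) (A : M.Sets) : ∃ B, IsMaximalD n B A := by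
  obtain ⟨J, hJ⟩ := exists_set_of_recursion (Φ := fun i F => ¬ IsConflict n A i F)
    (fun i F G h => not_congr (isConflict_congr h)) (definable_isConflict n A).not
  have hJ0 : M.mem 0 J := by
    -- a conflict would give `n ≥ 2` distinct sets, all equal to `A_0`
    rw [hJ]
    rintro ⟨x, hx, hinj, -⟩
    have hx0 : ∀ k, x k = 0 := fun k => (hx k).resolve_right fun h => (num_zero_le _).not_gt h.1
    have := @hinj ⟨0, by omega⟩ ⟨1, by omega⟩ (by simp [hx0])
    simp at this
  -- a family is indexed by all numbers, so `A_0` is put in the place of the sets that are skipped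
  obtain ⟨B, hB⟩ := Definable.exists_family (k := 0)
    (W := fun _ i x => (M.mem i J ∧ M.mem (npair x i) A) ∨ (¬ M.mem i J ∧ M.mem (npair x 0) A))
    (.or (.and (.mem (.var (k := 2) 0) J) (.mem (.npair (.var 1) (.var 0)) A))
      (.and (Definable.mem (.var 0) J).not (.mem (.npair (.var 1) .zero) A))) Fin.elim0
  have hBJ : ∀ i, M.mem i J → row B i = row A i := fun i hi => Set.ext fun x => by
    rw [hB]; simp [hi, row]
  have hBJ' : ∀ i, ¬ M.mem i J → row B i = row A 0 := fun i hi => Set.ext fun x => by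
    rw [hB]; simp [hi, row]
  have hBA : ∀ i, ∃ j, M.mem j J ∧ row B i = row A j := fun i => by
    by_cases hi : M.mem i J
    · exact ⟨i, hi, hBJ i hi⟩
    · exact ⟨0, hJ0, hBJ' i hi⟩
  refine ⟨B, fun i => (hBA i).imp fun j h => h.2, fun x hx ⟨y, hy⟩ => ?_, fun C hCA hCD hBC c => ?_⟩
  · choose j hj hrow using fun k => hBA (x k)
    simp only [hrow] at hx hy
    -- the largest of the indices `j k` would have been skipped
    have hne : (Finset.univ : Finset (Fin n)).Nonempty := ⟨⟨0, by omega⟩, Finset.mem_univ _⟩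
    obtain ⟨k₀, -, hk₀⟩ := Finset.exists_max_image Finset.univ j hne
    refine (hJ (j k₀)).1 (hj k₀) ⟨j, fun k => ?_, hx, y, hy⟩
    exact (hk₀ k (Finset.mem_univ k)).eq_or_lt.imp_right fun h => ⟨h, hj k⟩
  · obtain ⟨i, hi⟩ := hCA c
    by_cases hiJ : M.mem i J
    · exact ⟨i, hi.trans (hBJ i hiJ).symm⟩
    · rw [hJ, not_not] at hiJ
      obtain ⟨x, hx, hinj, y, hy⟩ := hiJ
      have hC : ∀ k, ∃ d, row A (x k) = row C d := fun k => by
        rcases hx k with h | ⟨-, h⟩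
        · exact ⟨c, by rw [h, hi]⟩
        · rw [← hBJ _ h]
          exact hBC _
      choose d hd using hC
      simp only [hd] at hinj hy
      exact absurd ⟨y, hy⟩ (hCD d hinj)

end greedy

end SOA

theorem propositionP (n : ℕ) (hn : 2 ≤ n) :
    SOA.Theory.EquivalentOver.{u} SOA.RCA0 {SOA.DnIP n} SOA.ACA0 := by
  refine ⟨fun φ hφ M hM => ?_, ?_⟩
  · have : SOA.ModelsRCA0 M := ⟨fun ψ h => hM ψ (Or.inl h)⟩
    have : SOA.SigmaComp M := SOA.sigmaComp_of_models_DnIP hn (hM _ (Or.inr rfl))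
    exact hφ.elim (fun h => hM φ (Or.inl h)) SOA.models_arithmeticalComprehension
  · rintro _ rfl M hM
    have : SOA.SigmaComp M := SOA.sigmaComp_of_models_ACA0 fun ψ h => hM ψ (Or.inr h)
    exact (SOA.models_DnIP n).2 fun A _ => SOA.exists_isMaximalD hn A
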